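/- Let $n\ge 1$ and $0<\lambda\le\Lambda$. There is a constant $c>0$, depending only on $n,\lambda,\Lambda$, such that the following holds. Let $x_0\in\mathbb R^n$, $R>0$, let $B(x,r)$ denote the open ball, and put $U=B(x_0,2R)$. Let $A(x)$, $x\in U$, be a measurable field of symmetric $n\times n$ matrices with $\lambda|\xi|^2\le\langle A(x)\xi,\xi\rangle\le\Lambda|\xi|^2$ for a.e. $x\in U$ and every $\xi\in\mathbb R^n$. Let $f:\mathbb R\to[0,\infty)$ be nondecreasing (jumps are allowed) and $F(t)=\int_0^t f(s)\,ds$. Let $u\in W^{1,2}(U)$ be continuous and nonnegative in $U$ with $u(x_0)>0$, and let $u$ be a weak subsolution of $\operatorname{div}(A(x)Du)\ge f(u)$ in $U$, that is, $$\int_U\langle A(x)Du,D\varphi\rangle\,dx\le-\int_U f(u)\varphi\,dx\qquad\text{for all nonnegative }\varphi\in W^{1,2}_0(U)$$ (in particular the right-hand side is finite). Denote $M=\sup_{B(x_0,R)}u$ and $m=\inf_{B(x_0,R)}u$. Then $$\int_{m/4}^{M}\frac{dt}{\sqrt{F(t)}}\ \ge\ c\,R ,$$ where the integral takes values in $[0,\infty]$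 and $1/\sqrt{F(t)}=\infty$ where $F(t)=0$. -/

import Mathlib

open MeasureTheory Filter Topology

noncomputable section

/-- A test function on `U`: an element of `C_c^∞(U)`, extended by zero to the whole space. -/
structure IsTestFunction {n : ℕ} (U : Set (EuclideanSpace ℝ (Fin n)))
    (φ : EuclideanSpace ℝ (Fin n) → ℝ) : Prop where
  smooth : ContDiff ℝ (⊤ : ℕ∞) φ
  compact_support : HasCompactSupport φ
  support_subset : tsupport φ ⊆ U

/-- `u ∈ W^{1,2}(U)`, with weak gradient `Du` on `U`. -/
structure IsW12 {n : ℕ} (U : Set (EuclideanSpace ℝ (Fin n)))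
    (u : EuclideanSpace ℝ (Fin n) → ℝ)
    (Du : EuclideanSpace ℝ (Fin n) → EuclideanSpace ℝ (Fin n)) : Prop where
  memLp : MemLp u 2 (volume.restrict U)
  memLp_grad : MemLp Du 2 (volume.restrict U)
  weak_grad : ∀ φ : EuclideanSpace ℝ (Fin n) → ℝ, IsTestFunction U φ → ∀ i : Fin n,
    ∫ x in U, u x * (gradient φ x) i = -∫ x in U, (Du x) i * φ x

/-- `φ ∈ W_0^{1,2}(U)`, with weak gradient `Dφ`: the function `φ` lies in the closure of
`C_c^∞(U)` in the norm of `W^{1,2}(U)`. -/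
structure IsW12Zero {n : ℕ} (U : Set (EuclideanSpace ℝ (Fin n)))
    (φ : EuclideanSpace ℝ (Fin n) → ℝ)
    (Dφ : EuclideanSpace ℝ (Fin n) → EuclideanSpace ℝ (Fin n)) : Prop where
  isW12 : IsW12 U φ Dφ
  approx : ∃ ψ : ℕ → EuclideanSpace ℝ (Fin n) → ℝ, (∀ k, IsTestFunction U (ψ k)) ∧
    Tendsto (fun k => eLpNorm (fun x => ψ k x - φ x) 2 (volume.restrict U)) atTop (𝓝 0) ∧
    Tendsto (fun k => eLpNorm (fun x => gradient (ψ k) x - Dφ x) 2 (volume.restrict U))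
      atTop (𝓝 0)

/-- The linear map `ξ ↦ A ξ` of Euclidean space given by the matrix `A`. -/
def matAct {n : ℕ} (A : Matrix (Fin n) (Fin n) ℝ) (ξ : EuclideanSpace ℝ (Fin n)) :
    EuclideanSpace ℝ (Fin n) :=
  WithLp.toLp 2 (Matrix.mulVec A ξ.ofLp)

/-- The coefficient field `A` is measurable, symmetric and uniformly elliptic on `U`, with
ellipticity constants `lam ≤ Lam`. -/
structure IsUniformlyElliptic {n : ℕ} (lam Lam : ℝ) (U : Set (EuclideanSpace ℝ (Fin n)))
    (A : EuclideanSpace ℝ (Fin n) → Matrix (Fin n) (Fin n) ℝ) : Prop where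
  aemeasurable : ∀ i j, AEMeasurable (fun x => A x i j) (volume.restrict U)
  symm : ∀ᵐ x ∂(volume.restrict U), (A x).IsSymm
  elliptic : ∀ᵐ x ∂(volume.restrict U), ∀ ξ : EuclideanSpace ℝ (Fin n),
    lam * ‖ξ‖ ^ 2 ≤ inner ℝ (matAct (A x) ξ) ξ ∧ inner ℝ (matAct (A x) ξ) ξ ≤ Lam * ‖ξ‖ ^ 2

/-- `u ∈ W^{1,2}(U)` is a weak subsolution in `U` of `div (A(x) Du) ≥ f(u)`:
`∫_U ⟨A Du, Dφ⟩ ≤ -∫_U f(u) φ` for all nonnegative `φ ∈ W_0^{1,2}(U)`.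
As `f ≥ 0`, the integral of `f(u) φ` always exists in `[0, ∞]`, and the inequality forces it to be
finite; this finiteness is the integrability clause. -/
def IsSubsolution {n : ℕ} (A : EuclideanSpace ℝ (Fin n) → Matrix (Fin n) (Fin n) ℝ) (f : ℝ → ℝ)
    (U : Set (EuclideanSpace ℝ (Fin n))) (u : EuclideanSpace ℝ (Fin n) → ℝ) : Prop :=
  ∃ Du : EuclideanSpace ℝ (Fin n) → EuclideanSpace ℝ (Fin n), IsW12 U u Du ∧
    ∀ (φ : EuclideanSpace ℝ (Fin n) → ℝ)
      (Dφ : EuclideanSpace ℝ (Fin n) → EuclideanSpace ℝ (Fin n)),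
      IsW12Zero U φ Dφ → (∀ᵐ x ∂(volume.restrict U), 0 ≤ φ x) →
      IntegrableOn (fun x => f (u x) * φ x) U ∧
      ∫ x in U, inner ℝ (matAct (A x) (Du x)) (Dφ x) ≤ -∫ x in U, f (u x) * φ x

/-- The primitive `F(t) = ∫_0^t f(s) ds`. -/
def primitive (f : ℝ → ℝ) (t : ℝ) : ℝ := ∫ s in (0 : ℝ)..t, f s

/-- The integral `∫_a^b dt / √F(t)` for `a ≤ b`, with values in `[0, ∞]`; the integrand is `∞`
where `F(t) = 0`. -/
def kellerIntegral (f : ℝ → ℝ) (a b : ℝ) : ENNReal :=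
  ∫⁻ t in Set.Ioc a b, (ENNReal.ofReal (Real.sqrt (primitive f t)))⁻¹

end

/-! The heart is a local estimate at one height, `exists_sq_mul_le_of_le_two_mul`: if `u y ≥ t` and
`u ≤ 2 * t` on the ball of radius `ρ` about `y`, then `ρ² f(t/2) ≤ C t`. By De Giorgi's lemma `u`
exceeds `t/2` on a fixed share of the half ball, since otherwise `u y ≤ 3t/4`. Testing the
inequality with `η² u₊³` gives `∫ f(u) η² u₊³ ≤ Λ ∫ u₊⁴ |Dη|²`. Since `f` is monotone, the left side
is at least a multiple of `f(t/2) t³ ρⁿ`, while the right side is at most a multiple of `t⁴ ρⁿ⁻²`.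

Consequently, starting from a point of height at least `t`, one meets the height `2t` within
distance about `√(t / f(t/2))`, provided this distance stays inside the ball. Because `F(s) ≤ s f(s)
≤ t f(t/2)` for `t/4 < s ≤ t/2`, that distance is at most a constant times `∫ ds/√F` over this
window. Doubling `t` moves to the adjacent window, so the windows of a chain of doublings are
disjoint and the integrals add up. The heights are bounded by `M`, so the chain stops after finitely
many steps, and it can stop only when the next step would be at least as long as the remaining
distance to the boundary. The total length is then at least `R`; starting at `x₀` with `t = u x₀ ≥
m` gives the bound.

Only `C¹` functions of `u` are used as test functions: `(u - k)₊²` and `(u - k)₊³` replace the usual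
`(u - k)₊`. The chain rule then follows from mollification and the local uniform convergence due to
the continuity of `u`. -/

noncomputable section

/-! ### Translations and averages in `L²` -/

section Mollification

open ContinuousLinearMap Convolution

variable {n : ℕ} {F : Type*} [NormedAddCommGroup F]

theorem eventually_eLpNorm_translate_sub_le {g : EuclideanSpace ℝ (Fin n) → F}
    (hg : MemLp g 2 volume) {ε : ENNReal} (hε : 0 < ε) :
    ∀ᶠ z in 𝓝 (0 : EuclideanSpace ℝ (Fin n)),
      eLpNorm (fun x => g (x - z) - g x) 2 volume ≤ ε := by
  let E := EuclideanSpace ℝ (Fin n)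
  have hmp : ∀ z : E, MeasurePreserving (fun x : E => x - z) volume volume :=
    fun z => measurePreserving_sub_right volume z
  have hc0 : Continuous (Function.uncurry (fun z x : E => x - z)) := by
    unfold Function.uncurry; fun_prop
  let c : E → C(E, E) := fun z => ⟨fun x => x - z, by fun_prop⟩
  have hc : Continuous c := ContinuousMap.continuous_of_continuous_uncurry _ hc0
  have : Fact ((1 : ENNReal) ≤ 2) := ⟨by norm_num⟩
  have h1 : Continuous (fun z : E => Lp.compMeasurePreserving (c z) (hmp z) (hg.toLp g)) :=
    Continuous.compMeasurePreservingLp (p := 2) continuous_const hc hmp (by norm_num)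
  have h2 := h1.tendsto 0
  have hev := (EMetric.tendsto_nhds.1 h2) ε hε
  filter_upwards [hev] with z hz
  rw [Set.mem_ofPred_eq, Lp.edist_def] at hz
  refine le_trans (le_of_eq ?_) hz.le
  apply eLpNorm_congr_ae
  have e1 : ∀ w : E, (Lp.compMeasurePreserving (c w) (hmp w) (hg.toLp g) : E → F)
      =ᵐ[volume] fun x => g (x - w) := by
    intro w
    refine (Lp.coeFn_compMeasurePreserving _ _).trans ?_
    exact (hmp w).quasiMeasurePreserving.ae_eq_comp hg.coeFn_toLp
  filter_upwards [e1 z, e1 0] with x h1 h2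
  rw [Set.mem_ofPred_eq] at h1 h2
  simp only [Pi.sub_apply, h1, h2, sub_zero]

variable [NormedSpace ℝ F] [CompleteSpace F]

/-- The density `ρ` defines a probability measure `ν`, and the difference is the `ν`-average of `g
(x - z) - g x`. Jensen's inequality for the square and Tonelli reduce the bound to single
translations `z` in the support of `ρ`. -/
theorem eLpNorm_convolution_sub_le {g : EuclideanSpace ℝ (Fin n) → F} (hg : MemLp g 2 volume)
    {ρ : EuclideanSpace ℝ (Fin n) → ℝ} (hρ : Continuous ρ) (hρc : HasCompactSupport ρ)
    (hρ0 : ∀ x, 0 ≤ ρ x) (hρ1 : ∫ x, ρ x = 1) {ε : ENNReal}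
    (hε : ∀ z ∈ Function.support ρ, eLpNorm (fun x => g (x - z) - g x) 2 volume ≤ ε) :
    eLpNorm (fun x => (ρ ⋆[lsmul ℝ ℝ, volume] g) x - g x) 2 volume ≤ ε := by
  let E := EuclideanSpace ℝ (Fin n)
  have hρi : Integrable ρ := hρ.integrable_of_hasCompactSupport hρc
  have hm : Measurable fun z : E => ENNReal.ofReal (ρ z) := hρ.measurable.ennreal_ofReal
  let ν : Measure E := volume.withDensity (fun z => ENNReal.ofReal (ρ z))
  have hν : IsProbabilityMeasure ν := ⟨by
    rw [withDensity_apply _ MeasurableSet.univ, Measure.restrict_univ,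
      ← ofReal_integral_eq_lintegral_ofReal hρi (ae_of_all _ hρ0), hρ1, ENNReal.ofReal_one]⟩
  have hac : ν ≪ volume := withDensity_absolutelyContinuous _ _
  have hgl : LocallyIntegrable g volume := hg.locallyIntegrable (by norm_num)
  have hconv : ∀ x : E, Integrable (fun z => g (x - z)) ν := by
    intro x
    have := HasCompactSupport.convolutionExists_left (lsmul ℝ ℝ) hρc hρ hgl x
    rw [integrable_withDensity_iff_integrable_smul₀' hm.aemeasurable (by simp)]
    refine this.congr (ae_of_all _ fun z => ?_)
    simp [ENNReal.toReal_ofReal (hρ0 z)]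
  have heq : ∀ x : E, (ρ ⋆[lsmul ℝ ℝ, volume] g) x - g x = ∫ z, (g (x - z) - g x) ∂ν := by
    intro x
    rw [integral_sub (hconv x) (integrable_const _), integral_const]
    simp only [probReal_univ, one_smul]
    congr 1
    rw [integral_withDensity_eq_integral_toReal_smul₀ hm.aemeasurable (by simp), convolution_def]
    refine integral_congr_ae (ae_of_all _ fun z => ?_)
    simp [ENNReal.toReal_ofReal (hρ0 z)]
  have hae2 : AEStronglyMeasurable (fun p : E × E => g (p.1 - p.2) - g p.1) (volume.prod ν) := by
    have a1 : AEStronglyMeasurable (fun p : E × E => g (p.1 - p.2)) (volume.prod volume) :=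
      hg.1.comp_quasiMeasurePreserving
        (quasiMeasurePreserving_sub_of_right_invariant volume volume)
    have hac2 : (volume : Measure E).prod ν ≪ volume.prod volume :=
      Measure.AbsolutelyContinuous.rfl.prod hac
    exact (a1.mono_ac hac2).sub hg.1.comp_fst
  have hpt : ∀ x : E, ‖(ρ ⋆[lsmul ℝ ℝ, volume] g) x - g x‖ₑ ^ 2
      ≤ ∫⁻ z, ‖g (x - z) - g x‖ₑ ^ 2 ∂ν := by
    intro x
    have hi : Integrable (fun z => g (x - z) - g x) ν := (hconv x).sub (integrable_const _)
    rw [heq x]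
    have h1 := enorm_integral_le_lintegral_enorm (μ := ν) (fun z => g (x - z) - g x)
    have h2 : eLpNorm (fun z => g (x - z) - g x) 1 ν ≤ eLpNorm (fun z => g (x - z) - g x) 2 ν :=
      eLpNorm_le_eLpNorm_of_exponent_le (by norm_num) hi.1
    rw [eLpNorm_one_eq_lintegral_enorm] at h2
    have h3 := pow_le_pow_left₀ zero_le (h1.trans h2) 2
    refine h3.trans (le_of_eq ?_)
    have := eLpNorm_nnreal_pow_eq_lintegral (f := fun z => g (x - z) - g x) (μ := ν)
      (p := 2) (by norm_num)
    simpa using this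
  have hsq : ∀ h : E → F, eLpNorm h 2 volume ^ 2 = ∫⁻ x, ‖h x‖ₑ ^ 2 := by
    intro h
    have := eLpNorm_nnreal_pow_eq_lintegral (f := h) (μ := (volume : Measure E))
      (p := 2) (by norm_num)
    simpa using this
  rw [← ENNReal.pow_le_pow_left_iff (n := 2) (by norm_num), hsq]
  calc ∫⁻ x, ‖(ρ ⋆[lsmul ℝ ℝ, volume] g) x - g x‖ₑ ^ 2
      ≤ ∫⁻ x, ∫⁻ z, ‖g (x - z) - g x‖ₑ ^ 2 ∂ν := lintegral_mono hpt
    _ = ∫⁻ z, ∫⁻ x, ‖g (x - z) - g x‖ₑ ^ 2 ∂volume ∂ν :=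
        lintegral_lintegral_swap (hae2.enorm.pow_const 2)
    _ ≤ ∫⁻ _z, ε ^ 2 ∂ν := by
        rw [lintegral_withDensity_eq_lintegral_mul_non_measurable _ hm (by simp),
          lintegral_withDensity_eq_lintegral_mul_non_measurable _ hm (by simp)]
        refine lintegral_mono fun z => ?_
        simp only [Pi.mul_apply]
        by_cases hz : ρ z = 0
        · simp [hz]
        · gcongr
          rw [← hsq]
          gcongr
          exact hε z hz
    _ = ε ^ 2 := by simp

end Mollification

/-! ### Mollification of Sobolev functions -/

section Mollify

open ContinuousLinearMap Convolution

variable {n : ℕ} {F : Type*} [NormedAddCommGroup F] [NormedSpace ℝ F]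

/-- A bump function around the origin with support of radius `1 / (k + 1)`. -/
def mollifier (n k : ℕ) : ContDiffBump (0 : EuclideanSpace ℝ (Fin n)) where
  rIn := 1 / (k + 2)
  rOut := 1 / (k + 1)
  rIn_pos := by positivity
  rIn_lt_rOut := by
    apply one_div_lt_one_div_of_lt <;> linarith [(Nat.cast_nonneg k : (0 : ℝ) ≤ k)]

/-- The mollification of `g` at scale `1 / (k + 1)`. -/
def mollify (k : ℕ) (g : EuclideanSpace ℝ (Fin n) → F) : EuclideanSpace ℝ (Fin n) → F :=
  (mollifier n k).normed volume ⋆[lsmul ℝ ℝ, volume] g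

theorem mollifier_rOut (n k : ℕ) : (mollifier n k).rOut = 1 / (k + 1) := rfl

theorem tendsto_mollifier_rOut (n : ℕ) :
    Tendsto (fun k => (mollifier n k).rOut) atTop (𝓝 0) := by
  simp only [mollifier_rOut]
  exact tendsto_one_div_add_atTop_nhds_zero_nat

theorem mollify_contDiff (k : ℕ) {g : EuclideanSpace ℝ (Fin n) → F}
    (hg : LocallyIntegrable g) : ContDiff ℝ (⊤ : ℕ∞) (mollify k g) :=
  (mollifier n k).hasCompactSupport_normed.contDiff_convolution_left _
    (mollifier n k).contDiff_normed hg

theorem support_mollify_subset (k : ℕ) (g : EuclideanSpace ℝ (Fin n) → F) :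
    Function.support (mollify k g) ⊆ Metric.cthickening (mollifier n k).rOut (tsupport g) := by
  intro x hx
  have h := support_convolution_subset (lsmul ℝ ℝ) hx
  obtain ⟨a, ha, b, hb, rfl⟩ := Set.mem_add.1 h
  rw [ContDiffBump.support_normed_eq] at ha
  refine Metric.mem_cthickening_of_dist_le _ b _ _ (subset_closure hb) ?_
  simpa [dist_eq_norm] using (mem_ball_zero_iff.1 ha).le

theorem tendsto_eLpNorm_mollify_sub [CompleteSpace F] {g : EuclideanSpace ℝ (Fin n) → F}
    (hg : MemLp g 2 volume) :
    Tendsto (fun k => eLpNorm (fun x => mollify k g x - g x) 2 volume) atTop (𝓝 0) := by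
  rw [ENNReal.tendsto_nhds_zero]
  intro ε hε
  obtain ⟨δ, hδ, hb⟩ := Metric.eventually_nhds_iff_ball.1
    (eventually_eLpNorm_translate_sub_le hg hε)
  filter_upwards [(tendsto_mollifier_rOut n).eventually (gt_mem_nhds hδ)] with k hk
  refine eLpNorm_convolution_sub_le hg (mollifier n k).continuous_normed
    (mollifier n k).hasCompactSupport_normed (mollifier n k).nonneg_normed
    (mollifier n k).integral_normed ?_
  intro z hz
  rw [ContDiffBump.support_normed_eq] at hz
  exact hb z (Metric.ball_subset_ball hk.le hz)

/-- Uniform, and not merely `L²`, convergence allows arbitrary continuous functions to be composed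
with the mollifications without growth conditions. -/
theorem tendstoUniformlyOn_mollify [CompleteSpace F] {U K : Set (EuclideanSpace ℝ (Fin n))}
    (hU : IsOpen U) (hK : IsCompact K) (hKU : K ⊆ U) {g : EuclideanSpace ℝ (Fin n) → F}
    (hg : ContinuousOn g U) (hgm : AEStronglyMeasurable g) :
    TendstoUniformlyOn (fun k => mollify k g) g atTop K := by
  rw [Metric.tendstoUniformlyOn_iff]
  intro ε hε
  obtain ⟨δ, hδ, hδU⟩ := hK.exists_cthickening_subset_open hU hKU
  have huc : UniformContinuousOn g (Metric.cthickening δ K) :=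
    hK.cthickening.uniformContinuousOn_of_continuous (hg.mono hδU)
  obtain ⟨η, hη, hη'⟩ := Metric.uniformContinuousOn_iff.1 huc (ε / 2) (by positivity)
  filter_upwards [(tendsto_mollifier_rOut n).eventually (gt_mem_nhds hδ),
    (tendsto_mollifier_rOut n).eventually (gt_mem_nhds hη)] with k hk1 hk2 x hx
  rw [dist_comm]
  refine lt_of_le_of_lt ((mollifier n k).dist_normed_convolution_le (ε := ε / 2) hgm ?_)
    (by linarith)
  intro y hy
  refine (hη' y ?_ x (Metric.self_subset_cthickening _ hx) ?_).le
  · exact Metric.mem_cthickening_of_dist_le y x _ _ hx ((Metric.mem_ball.1 hy).le.trans hk1.le)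
  · exact (Metric.mem_ball.1 hy).trans hk2

theorem gradient_apply_eq_fderiv {g : EuclideanSpace ℝ (Fin n) → ℝ} (x : EuclideanSpace ℝ (Fin n))
    (i : Fin n) : (gradient g x) i = fderiv ℝ g x (EuclideanSpace.single i 1) := by
  have h1 : inner ℝ (gradient g x) (EuclideanSpace.single i 1)
      = fderiv ℝ g x (EuclideanSpace.single i 1) := by
    rw [gradient, InnerProductSpace.toDual_symm_apply]
  rw [← h1, EuclideanSpace.inner_single_right]
  simp

/-- The derivative falls on the kernel `t ↦ ρ (x - t)`, which is a test function on `U` because its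
support lies in the ball `hx`; the definition of the weak gradient moves it to `u`. Nearer to the
boundary this would fail, as the extension by zero may jump. -/
theorem gradient_mollify {U : Set (EuclideanSpace ℝ (Fin n))} (hU : IsOpen U)
    {u : EuclideanSpace ℝ (Fin n) → ℝ} {Du : EuclideanSpace ℝ (Fin n) → EuclideanSpace ℝ (Fin n)}
    (h : IsW12 U u Du) {k : ℕ} {x : EuclideanSpace ℝ (Fin n)}
    (hx : Metric.closedBall x (mollifier n k).rOut ⊆ U) :
    gradient (mollify k (U.indicator u)) x = mollify k (U.indicator Du) x := by
  let E := EuclideanSpace ℝ (Fin n)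
  set ρ : E → ℝ := (mollifier n k).normed volume with hρdef
  have hρ : ContDiff ℝ (⊤ : ℕ∞) ρ := (mollifier n k).contDiff_normed
  have hρ1 : ContDiff ℝ 1 ρ := hρ.of_le (by exact_mod_cast le_top)
  have hρc : HasCompactSupport ρ := (mollifier n k).hasCompactSupport_normed
  have hul : LocallyIntegrable (U.indicator u) :=
    ((memLp_indicator_iff_restrict hU.measurableSet).2 h.memLp).locallyIntegrable (by norm_num)
  have hDl : LocallyIntegrable (U.indicator Du) :=
    ((memLp_indicator_iff_restrict hU.measurableSet).2 h.memLp_grad).locallyIntegrable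
      (by norm_num)
  have hdcont : Continuous (fderiv ℝ ρ) := hρ1.continuous_fderiv one_ne_zero
  have hfd := (hρc.hasFDerivAt_convolution_left (lsmul ℝ ℝ) hρ1 hul x).fderiv
  let ζ : E → ℝ := fun t => ρ (x - t)
  have hζs : ContDiff ℝ (⊤ : ℕ∞) ζ := hρ.comp (contDiff_const.sub contDiff_id)
  have hζts : tsupport ζ ⊆ Metric.closedBall x (mollifier n k).rOut := by
    refine closure_minimal ?_ Metric.isClosed_closedBall
    intro t ht
    have : x - t ∈ Function.support ρ := ht
    rw [hρdef, ContDiffBump.support_normed_eq, mem_ball_zero_iff] at this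
    rw [Metric.mem_closedBall, dist_comm, dist_eq_norm]
    exact this.le
  have hζ : IsTestFunction U ζ :=
    ⟨hζs, HasCompactSupport.intro (isCompact_closedBall x (mollifier n k).rOut)
      (fun t ht => by
        by_contra h0
        exact ht (hζts (subset_tsupport _ h0))), hζts.trans hx⟩
  ext i
  have hweak := h.weak_grad ζ hζ i
  set v : E := EuclideanSpace.single i 1 with hv
  have hdζ : ∀ t, (gradient ζ t) i = -(fderiv ℝ ρ (x - t) v) := by
    intro t
    rw [gradient_apply_eq_fderiv]
    have h1 : HasFDerivAt (fun t : E => x - t) (-ContinuousLinearMap.id ℝ E) t := by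
      simpa using (hasFDerivAt_id t).const_sub x
    have h2 := ((hρ1.differentiable one_ne_zero) (x - t)).hasFDerivAt.comp t h1
    rw [show ζ = ρ ∘ fun t => x - t from rfl, h2.fderiv]
    simp [hv]
  rw [gradient_apply_eq_fderiv]
  have e1 : fderiv ℝ (mollify k (U.indicator u)) x v
      = ∫ t, fderiv ℝ ρ (x - t) v * U.indicator u t := by
    rw [mollify, hfd, convolution_eq_swap, ContinuousLinearMap.integral_apply]
    · rfl
    · have := (hρc.fderiv (𝕜 := ℝ)).convolutionExists_left ((lsmul ℝ ℝ).precompL E) hdcont hul x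
      exact this.integrable_swap
  have e2 : (mollify k (U.indicator Du) x) i = ∫ t, ρ (x - t) * (U.indicator Du t) i := by
    rw [mollify, convolution_eq_swap]
    have hint := (hρc.convolutionExists_left (lsmul ℝ ℝ) hρ1.continuous hDl x).integrable_swap
    have := (EuclideanSpace.proj (𝕜 := ℝ) i).integral_comp_comm hint
    exact this.symm
  rw [e1, e2]
  have e3 : ∫ t, fderiv ℝ ρ (x - t) v * U.indicator u t
      = - ∫ t in U, u t * (gradient ζ t) i := by
    rw [← integral_indicator hU.measurableSet, ← integral_neg]
    refine integral_congr_ae (ae_of_all _ fun t => ?_)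
    by_cases ht : t ∈ U
    · simp [ht, hdζ]; ring
    · simp [ht]
  rw [e3, hweak, neg_neg, ← integral_indicator hU.measurableSet]
  refine integral_congr_ae (ae_of_all _ fun t => ?_)
  by_cases ht : t ∈ U
  · simp [ht, ζ, mul_comm]
  · simp [ht]

/-- Mollification approximates the weak gradient in `L²` on compact subsets. -/
theorem tendsto_eLpNorm_gradient_mollify_sub {U K : Set (EuclideanSpace ℝ (Fin n))}
    (hU : IsOpen U) (hK : IsCompact K) (hKU : K ⊆ U)
    {u : EuclideanSpace ℝ (Fin n) → ℝ} {Du : EuclideanSpace ℝ (Fin n) → EuclideanSpace ℝ (Fin n)}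
    (h : IsW12 U u Du) :
    Tendsto (fun k => eLpNorm (fun x => gradient (mollify k (U.indicator u)) x - Du x) 2
      (volume.restrict K)) atTop (𝓝 0) := by
  obtain ⟨δ, hδ, hδU⟩ := hK.exists_cthickening_subset_open hU hKU
  have hDm : MemLp (U.indicator Du) 2 volume :=
    (memLp_indicator_iff_restrict hU.measurableSet).2 h.memLp_grad
  have hD := tendsto_eLpNorm_mollify_sub hDm
  refine tendsto_of_tendsto_of_tendsto_of_le_of_le' tendsto_const_nhds hD ?_ ?_
  · exact Eventually.of_forall fun _ => zero_le
  filter_upwards [(tendsto_mollifier_rOut n).eventually (gt_mem_nhds hδ)] with k hk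
  rw [eLpNorm_congr_ae (g := fun x => mollify k (U.indicator Du) x - U.indicator Du x)]
  · exact eLpNorm_mono_measure _ Measure.restrict_le_self
  filter_upwards [ae_restrict_mem hK.measurableSet] with x hx
  have hball : Metric.closedBall x (mollifier n k).rOut ⊆ U :=
    (Metric.closedBall_subset_closedBall hk.le).trans
      ((Metric.closedBall_subset_cthickening hx δ).trans hδU)
  rw [gradient_mollify hU h hball, Set.indicator_of_mem (hKU hx)]

end Mollify

/-! ### Closure properties of `W^{1,2}` and `W_0^{1,2}` -/

section Chain

variable {n : ℕ}

theorem tendsto_integral_mul_of_tendsto_eLpNorm {α : Type*} [MeasurableSpace α] {μ : Measure α}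
    {f : α → ℝ} {F : ℕ → α → ℝ} {h : α → ℝ} (hf : MemLp f 2 μ) (hF : ∀ k, MemLp (F k) 2 μ)
    (hh : MemLp h 2 μ) (hlim : Tendsto (fun k => eLpNorm (fun x => F k x - f x) 2 μ) atTop (𝓝 0)) :
    Tendsto (fun k => ∫ x, F k x * h x ∂μ) atTop (𝓝 (∫ x, f x * h x ∂μ)) := by
  refine tendsto_integral_of_L1' _ (hf.integrable_mul hh).1
    (Eventually.of_forall fun k => (hF k).integrable_mul hh) ?_
  have hb : Tendsto (fun k => eLpNorm (fun x => F k x - f x) 2 μ * eLpNorm h 2 μ) atTop (𝓝 0) := by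
    have := ENNReal.Tendsto.mul_const (b := eLpNorm h 2 μ) hlim (Or.inr hh.2.ne)
    simpa using this
  refine tendsto_of_tendsto_of_tendsto_of_le_of_le tendsto_const_nhds hb (fun _ => zero_le)
    fun k => ?_
  have h1 := eLpNorm_smul_le_mul_eLpNorm (p := 2) (q := 2) (r := 1) hh.1 ((hF k).sub hf).1
  refine le_trans (le_of_eq ?_) h1
  congr 1
  ext x
  simp [sub_mul]

theorem IsTestFunction.memLp {U : Set (EuclideanSpace ℝ (Fin n))}
    {ζ : EuclideanSpace ℝ (Fin n) → ℝ} (hζ : IsTestFunction U ζ) (p : ENNReal)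
    (μ : Measure (EuclideanSpace ℝ (Fin n))) [IsFiniteMeasureOnCompacts μ] : MemLp ζ p μ :=
  hζ.smooth.continuous.memLp_of_hasCompactSupport hζ.compact_support

theorem continuous_gradient {φ : EuclideanSpace ℝ (Fin n) → ℝ} (hφ : ContDiff ℝ 1 φ) :
    Continuous (gradient φ) :=
  (InnerProductSpace.toDual ℝ _).symm.continuous.comp (hφ.continuous_fderiv one_ne_zero)

theorem norm_gradient_eq {φ : EuclideanSpace ℝ (Fin n) → ℝ} (x : EuclideanSpace ℝ (Fin n)) :
    ‖gradient φ x‖ = ‖fderiv ℝ φ x‖ :=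
  (InnerProductSpace.toDual ℝ _).symm.norm_map _

theorem support_gradient_subset (φ : EuclideanSpace ℝ (Fin n) → ℝ) :
    Function.support (gradient φ) ⊆ tsupport φ := by
  intro x hx
  refine support_fderiv_subset ℝ (f := φ) ?_
  rw [Function.mem_support] at hx ⊢
  rwa [← norm_ne_zero_iff, ← norm_gradient_eq, norm_ne_zero_iff]

theorem hasCompactSupport_gradient {φ : EuclideanSpace ℝ (Fin n) → ℝ} (hφ : HasCompactSupport φ) :
    HasCompactSupport (gradient φ) :=
  hφ.mono' (support_gradient_subset φ)

theorem IsTestFunction.contDiff_one {U : Set (EuclideanSpace ℝ (Fin n))}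
    {ζ : EuclideanSpace ℝ (Fin n) → ℝ} (hζ : IsTestFunction U ζ) : ContDiff ℝ 1 ζ :=
  hζ.smooth.of_le (by exact_mod_cast le_top)

theorem IsTestFunction.memLp_gradient {U : Set (EuclideanSpace ℝ (Fin n))}
    {ζ : EuclideanSpace ℝ (Fin n) → ℝ} (hζ : IsTestFunction U ζ) (p : ENNReal)
    (μ : Measure (EuclideanSpace ℝ (Fin n))) [IsFiniteMeasureOnCompacts μ] :
    MemLp (gradient ζ) p μ :=
  (continuous_gradient hζ.contDiff_one).memLp_of_hasCompactSupport
    (hasCompactSupport_gradient hζ.compact_support)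

theorem memLp_coord {α : Type*} [MeasurableSpace α] {μ : Measure α} {p : ENNReal}
    {g : α → EuclideanSpace ℝ (Fin n)} (hg : MemLp g p μ) (i : Fin n) :
    MemLp (fun x => g x i) p μ :=
  (EuclideanSpace.proj (𝕜 := ℝ) i).comp_memLp' hg

theorem isW12_of_contDiff {U : Set (EuclideanSpace ℝ (Fin n))}
    {w : EuclideanSpace ℝ (Fin n) → ℝ} (hw : ContDiff ℝ 1 w) (hc : HasCompactSupport w) :
    IsW12 U w (gradient w) := by
  have hgc := continuous_gradient hw
  have hgs := hasCompactSupport_gradient hc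
  refine ⟨hw.continuous.memLp_of_hasCompactSupport hc, hgc.memLp_of_hasCompactSupport hgs, ?_⟩
  intro ζ hζ i
  have hi : Continuous fun x => (gradient w x) i :=
    (EuclideanSpace.proj (𝕜 := ℝ) i).continuous.comp hgc
  have hi' : Continuous fun x => (gradient ζ x) i :=
    (EuclideanSpace.proj (𝕜 := ℝ) i).continuous.comp (continuous_gradient hζ.contDiff_one)
  have hcv := hζ.smooth.continuous
  rw [setIntegral_eq_integral_of_forall_compl_eq_zero,
    setIntegral_eq_integral_of_forall_compl_eq_zero]
  · simp only [gradient_apply_eq_fderiv] at hi hi' ⊢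
    refine integral_mul_fderiv_eq_neg_fderiv_mul_of_integrable ?_ ?_ ?_
      (fun x _ => hw.differentiable one_ne_zero x)
      (fun x _ => hζ.contDiff_one.differentiable one_ne_zero x)
    · exact (hi.mul hcv).integrable_of_hasCompactSupport hζ.compact_support.mul_left
    · exact (hw.continuous.mul hi').integrable_of_hasCompactSupport hc.mul_right
    · exact (hw.continuous.mul hcv).integrable_of_hasCompactSupport hc.mul_right
  · intro x hx
    have : ζ x = 0 := image_eq_zero_of_notMem_tsupport fun h => hx (hζ.support_subset h)
    simp [this]
  · intro x hx
    have : gradient ζ x = 0 := by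
      by_contra h
      exact hx (hζ.support_subset (support_gradient_subset ζ h))
    simp [this]

/-- Both sides of the weak gradient identity are continuous under `L²` convergence when the test
function is fixed. -/
theorem IsW12.of_tendsto {U : Set (EuclideanSpace ℝ (Fin n))}
    {v : EuclideanSpace ℝ (Fin n) → ℝ} {Dv : EuclideanSpace ℝ (Fin n) → EuclideanSpace ℝ (Fin n)}
    {w : ℕ → EuclideanSpace ℝ (Fin n) → ℝ}
    {Dw : ℕ → EuclideanSpace ℝ (Fin n) → EuclideanSpace ℝ (Fin n)}
    (hw : ∀ k, IsW12 U (w k) (Dw k))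
    (hv : MemLp v 2 (volume.restrict U)) (hDv : MemLp Dv 2 (volume.restrict U))
    (hlim : Tendsto (fun k => eLpNorm (fun x => w k x - v x) 2 (volume.restrict U)) atTop (𝓝 0))
    (hDlim : Tendsto (fun k => eLpNorm (fun x => Dw k x - Dv x) 2 (volume.restrict U))
      atTop (𝓝 0)) :
    IsW12 U v Dv := by
  refine ⟨hv, hDv, fun ζ hζ i => ?_⟩
  have h1 := tendsto_integral_mul_of_tendsto_eLpNorm hv (fun k => (hw k).memLp)
    (memLp_coord (hζ.memLp_gradient 2 _) i) hlim
  have h2 := tendsto_integral_mul_of_tendsto_eLpNorm (memLp_coord hDv i)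
    (fun k => memLp_coord (hw k).memLp_grad i) (hζ.memLp 2 _) (by
      refine tendsto_of_tendsto_of_tendsto_of_le_of_le tendsto_const_nhds hDlim
        (fun _ => zero_le) fun k => ?_
      refine eLpNorm_mono fun x => ?_
      exact PiLp.norm_apply_le (Dw k x - Dv x) i)
  refine tendsto_nhds_unique h1 ?_
  simp only [(hw _).weak_grad ζ hζ i]
  exact h2.neg

theorem IsW12.isW12Zero_of_support_subset {U K : Set (EuclideanSpace ℝ (Fin n))}
    (hU : IsOpen U) (hK : IsCompact K) (hKU : K ⊆ U)
    {v : EuclideanSpace ℝ (Fin n) → ℝ} {Dv : EuclideanSpace ℝ (Fin n) → EuclideanSpace ℝ (Fin n)}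
    (h : IsW12 U v Dv) (hv : Function.support v ⊆ K) (hDv : Function.support Dv ⊆ K) :
    IsW12Zero U v Dv := by
  refine ⟨h, ?_⟩
  obtain ⟨δ, hδ, hδU⟩ := hK.exists_cthickening_subset_open hU hKU
  obtain ⟨N, hN⟩ := eventually_atTop.1
    ((tendsto_mollifier_rOut n).eventually (gt_mem_nhds hδ))
  have hvi : U.indicator v = v := Set.indicator_eq_self.2 (hv.trans hKU)
  have hvm : MemLp v 2 volume := by
    rw [← hvi]
    exact (memLp_indicator_iff_restrict hU.measurableSet).2 h.memLp
  have hts : ∀ k, tsupport (mollify (k + N) v) ⊆ Metric.cthickening δ K := by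
    intro k
    refine closure_minimal ?_ Metric.isClosed_cthickening
    refine (support_mollify_subset _ _).trans ?_
    refine (Metric.cthickening_mono (hN (k + N) (by omega)).le _).trans ?_
    exact Metric.cthickening_subset_of_subset _ (closure_minimal hv hK.isClosed)
  -- The shift by `N` keeps every support inside the thickening of `K`, hence inside `U`.
  refine ⟨fun k => mollify (k + N) v, fun k => ⟨?_, ?_, ?_⟩, ?_, ?_⟩
  · exact mollify_contDiff _ (hvm.locallyIntegrable (by norm_num))
  · exact HasCompactSupport.of_support_subset_isCompact hK.cthickening
      ((subset_tsupport _).trans (hts k))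
  · exact (hts k).trans hδU
  · have h1 := (tendsto_eLpNorm_mollify_sub hvm).comp (tendsto_add_atTop_nat N)
    refine tendsto_of_tendsto_of_tendsto_of_le_of_le tendsto_const_nhds h1
      (fun _ => zero_le) fun k => ?_
    exact eLpNorm_mono_measure _ Measure.restrict_le_self
  · have h1 := (tendsto_eLpNorm_gradient_mollify_sub hU hK.cthickening hδU h).comp
      (tendsto_add_atTop_nat N)
    rw [hvi] at h1
    refine h1.congr fun k => ?_
    have hs : Function.support (fun x => gradient (mollify (k + N) v) x - Dv x)
        ⊆ Metric.cthickening δ K := by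
      refine (Function.support_sub _ _).trans (Set.union_subset ?_ ?_)
      · exact (support_gradient_subset _).trans (hts k)
      · exact hDv.trans (Metric.self_subset_cthickening _)
    simp only [Function.comp_apply]
    rw [eLpNorm_restrict_eq_of_support_subset hs,
      eLpNorm_restrict_eq_of_support_subset (hs.trans hδU)]

theorem tendsto_eLpNorm_smul_of_tendstoUniformlyOn {X : Type*} [MeasurableSpace X] {μ : Measure X}
    {F : Type*} [NormedAddCommGroup F] [NormedSpace ℝ F] {K : Set X} (hK : MeasurableSet K)
    {a : ℕ → X → ℝ} {b : X → ℝ} (hab : TendstoUniformlyOn a b atTop K) {h : X → F}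
    (hh : eLpNorm h 2 (μ.restrict K) ≠ ⊤) :
    Tendsto (fun k => eLpNorm (fun x => (a k x - b x) • h x) 2 (μ.restrict K)) atTop (𝓝 0) := by
  rw [ENNReal.tendsto_nhds_zero]
  intro ε hε
  have h0 : Tendsto (fun δ : ℝ => ENNReal.ofReal δ * eLpNorm h 2 (μ.restrict K)) (𝓝[>] 0) (𝓝 0) := by
    have h1 : Tendsto (fun δ : ℝ => ENNReal.ofReal δ) (𝓝[>] 0) (𝓝 0) := by
      have := (ENNReal.continuous_ofReal.tendsto 0)
      rw [ENNReal.ofReal_zero] at this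
      exact this.mono_left nhdsWithin_le_nhds
    simpa using ENNReal.Tendsto.mul_const (b := eLpNorm h 2 (μ.restrict K)) h1 (Or.inr hh)
  obtain ⟨δ, hδε, hδ⟩ := ((ENNReal.tendsto_nhds_zero.1 h0 ε hε).and self_mem_nhdsWithin).exists
  filter_upwards [Metric.tendstoUniformlyOn_iff.1 hab δ hδ] with k hk
  refine le_trans (eLpNorm_le_mul_eLpNorm_of_ae_le_mul (c := δ) (g := h) ?_ 2) hδε
  filter_upwards [ae_restrict_mem hK] with x hx
  rw [norm_smul]
  gcongr
  rw [← dist_eq_norm, dist_comm]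
  exact (hk x hx).le

/-- Since `b` is bounded by `M` on `K`, the functions `a k` eventually take values in `[-(M + 1), M
+ 1]`, where `g` is uniformly continuous. -/
theorem tendstoUniformlyOn_comp_of_continuous {X : Type*} {K : Set X} {a : ℕ → X → ℝ} {b : X → ℝ}
    (hab : TendstoUniformlyOn a b atTop K) {M : ℝ} (hb : ∀ x ∈ K, |b x| ≤ M) {g : ℝ → ℝ}
    (hg : Continuous g) : TendstoUniformlyOn (fun k x => g (a k x)) (fun x => g (b x)) atTop K := by
  have huc : UniformContinuousOn g (Metric.closedBall 0 (M + 1)) :=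
    (isCompact_closedBall _ _).uniformContinuousOn_of_continuous hg.continuousOn
  rw [Metric.tendstoUniformlyOn_iff]
  intro ε hε
  obtain ⟨δ, hδ, hδ'⟩ := Metric.uniformContinuousOn_iff.1 huc ε hε
  filter_upwards [Metric.tendstoUniformlyOn_iff.1 hab δ hδ,
    Metric.tendstoUniformlyOn_iff.1 hab 1 one_pos] with k hk1 hk2 x hx
  refine hδ' _ ?_ _ ?_ (hk1 x hx)
  · have := hb x hx
    rw [mem_closedBall_zero_iff, Real.norm_eq_abs]; linarith
  · have h1 := hb x hx
    have h2 := hk2 x hx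
    rw [Real.dist_eq] at h2
    rw [mem_closedBall_zero_iff, Real.norm_eq_abs]
    have : |a k x| ≤ |b x| + |b x - a k x| := by
      rw [abs_sub_comm]; have := abs_add_le (b x) (a k x - b x); simpa using this
    linarith

theorem gradient_mul_comp {η w : EuclideanSpace ℝ (Fin n) → ℝ} {g g' : ℝ → ℝ}
    {x : EuclideanSpace ℝ (Fin n)} (hη : DifferentiableAt ℝ η x) (hw : DifferentiableAt ℝ w x)
    (hg : HasDerivAt g (g' (w x)) (w x)) :
    gradient (fun y => η y * g (w y)) x
      = g (w x) • gradient η x + (η x * g' (w x)) • gradient w x := by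
  apply HasGradientAt.gradient
  rw [hasGradientAt_iff_hasFDerivAt]
  have h1 := hη.hasFDerivAt.mul (hg.comp_hasFDerivAt x hw.hasFDerivAt)
  refine h1.congr_fderiv ?_
  ext y
  simp [gradient]
  ring

end Chain

/-! ### Chain rule and admissible test functions -/

section ChainRule

variable {n : ℕ}

/-- Chain rule: a compactly supported cutoff of a `C¹` function of a continuous `W^{1,2}`
function belongs to `W_0^{1,2}`. -/
theorem IsW12.isW12Zero_mul_comp {U : Set (EuclideanSpace ℝ (Fin n))} (hU : IsOpen U)
    {u : EuclideanSpace ℝ (Fin n) → ℝ} {Du : EuclideanSpace ℝ (Fin n) → EuclideanSpace ℝ (Fin n)}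
    (h : IsW12 U u Du) (hu : ContinuousOn u U)
    {η : EuclideanSpace ℝ (Fin n) → ℝ} (hη : IsTestFunction U η) {g g' : ℝ → ℝ}
    (hg : ∀ s, HasDerivAt g (g' s) s) (hg' : Continuous g') :
    IsW12Zero U (fun x => η x * g (u x))
      (fun x => g (u x) • gradient η x + (η x * g' (u x)) • Du x) := by
  let E := EuclideanSpace ℝ (Fin n)
  set K := tsupport η with hKdef
  have hK : IsCompact K := hη.compact_support
  have hKU : K ⊆ U := hη.support_subset
  have hKm : MeasurableSet K := hK.measurableSet
  have hgc : Continuous g := continuous_iff_continuousAt.2 fun s => (hg s).continuousAt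
  have hg1 : ContDiff ℝ 1 g := contDiff_one_iff_deriv.2
    ⟨fun s => (hg s).differentiableAt, by
      rw [show deriv g = g' from funext fun s => (hg s).deriv]; exact hg'⟩
  have hη1 := hη.contDiff_one
  have hηc := hη.smooth.continuous
  have hdηc := continuous_gradient hη1
  have hηK : ∀ x, x ∉ K → η x = 0 := fun x hx => image_eq_zero_of_notMem_tsupport hx
  have hdηK : ∀ x, x ∉ K → gradient η x = 0 := fun x hx => by
    by_contra h0; exact hx (support_gradient_subset η h0)
  let w : ℕ → E → ℝ := fun k => mollify k (U.indicator u)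
  have hum : MemLp (U.indicator u) 2 volume :=
    (memLp_indicator_iff_restrict hU.measurableSet).2 h.memLp
  have hw1 : ∀ k, ContDiff ℝ 1 (w k) := fun k =>
    (mollify_contDiff k (hum.locallyIntegrable (by norm_num))).of_le (by exact_mod_cast le_top)
  have hwu : TendstoUniformlyOn w u atTop K := by
    have h1 := tendstoUniformlyOn_mollify hU hK hKU
      (hu.congr fun x hx => Set.indicator_of_mem hx u) hum.1
    exact h1.congr_right fun x hx => Set.indicator_of_mem (hKU hx) u
  obtain ⟨M, hM⟩ : ∃ M : ℝ, ∀ x ∈ K, |u x| ≤ M := by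
    obtain ⟨M, hM⟩ := hK.exists_bound_of_continuousOn (hu.mono hKU)
    exact ⟨M, fun x hx => hM x hx⟩
  have hG := tendstoUniformlyOn_comp_of_continuous hwu hM hgc
  have hG' := tendstoUniformlyOn_comp_of_continuous hwu hM hg'
  have bdd : ∀ q : ℝ → ℝ, Continuous q → ∃ C : ℝ, 0 ≤ C ∧ ∀ s, |s| ≤ M + 1 → |q s| ≤ C := by
    intro q hq
    obtain ⟨C, hC⟩ := (isCompact_closedBall (0 : ℝ) (M + 1)).exists_bound_of_continuousOn
      hq.continuousOn
    exact ⟨|C|, abs_nonneg C, fun s hs => (hC s (by simpa using hs)).trans (le_abs_self C)⟩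
  obtain ⟨Cg, -, hCg⟩ := bdd g hgc
  obtain ⟨Cg', hCg'0, hCg'⟩ := bdd g' hg'
  obtain ⟨Cη, hCη⟩ : ∃ C : ℝ, ∀ x, |η x| ≤ C := hηc.bounded_above_of_compact_support
    hη.compact_support
  have hCη0 : 0 ≤ Cη := (abs_nonneg _).trans (hCη 0)
  have hgu : ContinuousOn (fun x => g (u x)) U := hgc.comp_continuousOn hu
  have hg'u : ContinuousOn (fun x => g' (u x)) U := hg'.comp_continuousOn hu
  set v : E → ℝ := fun x => η x * g (u x) with hvdef
  set Dv : E → E := fun x => g (u x) • gradient η x + (η x * g' (u x)) • Du x with hDvdef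
  have hvs : Function.support v ⊆ K := by
    intro x hx; by_contra h0; exact hx (by simp [hvdef, hηK x h0])
  have hDvs : Function.support Dv ⊆ K := by
    intro x hx; by_contra h0; exact hx (by simp [hDvdef, hηK x h0, hdηK x h0])
  have hvm : MemLp v 2 (volume.restrict U) := by
    refine (hη.memLp 2 (volume.restrict U)).of_le_mul (c := Cg) ?_ (ae_of_all _ fun x => ?_)
    · exact (hηc.continuousOn.mul hgu).aestronglyMeasurable hU.measurableSet
    · by_cases hx : x ∈ K
      · rw [hvdef, norm_mul, mul_comm]
        gcongr
        exact hCg _ ((hM x hx).trans (by linarith))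
      · simp [hvdef, hηK x hx]
  have hDvm : MemLp Dv 2 (volume.restrict U) := by
    refine MemLp.add ?_ ?_
    · refine (hη.memLp_gradient 2 (volume.restrict U)).of_le_mul (c := Cg) ?_
        (ae_of_all _ fun x => ?_)
      · exact (hgu.smul hdηc.continuousOn).aestronglyMeasurable hU.measurableSet
      · by_cases hx : x ∈ K
        · rw [norm_smul]
          gcongr
          exact hCg _ ((hM x hx).trans (by linarith))
        · simp [hdηK x hx]
    · refine h.memLp_grad.of_le_mul (c := Cη * Cg') ?_ (ae_of_all _ fun x => ?_)
      · exact ((hηc.continuousOn.mul hg'u).aestronglyMeasurable hU.measurableSet).smul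
          h.memLp_grad.1
      · by_cases hx : x ∈ K
        · rw [norm_smul, norm_mul]
          gcongr
          · exact hCη x
          · exact hCg' _ ((hM x hx).trans (by linarith))
        · simp only [hηK x hx, zero_mul, zero_smul, norm_zero]
          positivity
  let V : ℕ → E → ℝ := fun k x => η x * g (w k x)
  have hVc : ∀ k, ContDiff ℝ 1 (V k) := fun k => hη1.mul (hg1.comp (hw1 k))
  have hVt : ∀ k, HasCompactSupport (V k) := fun k => hη.compact_support.mul_right
  have hgradV : ∀ k x, gradient (V k) x
      = g (w k x) • gradient η x + (η x * g' (w k x)) • gradient (w k) x := fun k x =>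
    gradient_mul_comp (hη1.differentiable one_ne_zero x) ((hw1 k).differentiable one_ne_zero x)
      (hg _)
  have hres : ∀ {F : Type} [NormedAddCommGroup F] (q : E → F), (∀ x, x ∉ K → q x = 0) →
      eLpNorm q 2 (volume.restrict U) = eLpNorm q 2 (volume.restrict K) := by
    intro F _ q hq
    have hs : Function.support q ⊆ K := fun x hx => by_contra fun h0 => hx (hq x h0)
    rw [eLpNorm_restrict_eq_of_support_subset hs,
      eLpNorm_restrict_eq_of_support_subset (hs.trans hKU)]
  have hlim : Tendsto (fun k => eLpNorm (fun x => V k x - v x) 2 (volume.restrict U))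
      atTop (𝓝 0) := by
    have h1 := tendsto_eLpNorm_smul_of_tendstoUniformlyOn (μ := volume) hKm hG
      (hη.memLp 2 (volume.restrict K)).2.ne
    refine h1.congr fun k => ?_
    rw [hres]
    · congr 1
      ext x
      simp only [V, hvdef, smul_eq_mul]
      ring
    · intro x hx
      simp [V, hvdef, hηK x hx]
  have hDlim : Tendsto (fun k => eLpNorm (fun x => gradient (V k) x - Dv x) 2
      (volume.restrict U)) atTop (𝓝 0) := by
    have hDuK : MemLp Du 2 (volume.restrict K) :=
      h.memLp_grad.mono_measure (Measure.restrict_mono hKU le_rfl)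
    have h1 := tendsto_eLpNorm_smul_of_tendstoUniformlyOn (μ := volume) hKm hG
      (hη.memLp_gradient 2 (volume.restrict K)).2.ne
    have hηDu : MemLp (fun x => η x • Du x) 2 (volume.restrict K) := by
      refine hDuK.of_le_mul (c := Cη) (hηc.aestronglyMeasurable.smul hDuK.1)
        (ae_of_all _ fun x => ?_)
      rw [norm_smul]
      gcongr
      exact hCη x
    have h3 := tendsto_eLpNorm_smul_of_tendstoUniformlyOn (μ := volume) hKm hG' hηDu.2.ne
    have h2 : Tendsto (fun k => ENNReal.ofReal (Cη * Cg') *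
        eLpNorm (fun x => gradient (w k) x - Du x) 2 (volume.restrict K)) atTop (𝓝 0) := by
      have := ENNReal.Tendsto.const_mul (a := ENNReal.ofReal (Cη * Cg'))
        (tendsto_eLpNorm_gradient_mollify_sub hU hK hKU h) (Or.inr ENNReal.ofReal_ne_top)
      simpa using this
    have hsum := (h1.add h2).add h3
    simp only [add_zero] at hsum
    refine tendsto_of_tendsto_of_tendsto_of_le_of_le' tendsto_const_nhds hsum
      (Eventually.of_forall fun _ => zero_le) ?_
    filter_upwards [Metric.tendstoUniformlyOn_iff.1 hwu 1 one_pos] with k hk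
    rw [hres]
    swap
    · intro x hx
      simp [hgradV, hDvdef, hηK x hx, hdηK x hx]
    have hwc : Continuous (w k) := (hw1 k).continuous
    have huKm : AEStronglyMeasurable u (volume.restrict K) :=
      (hu.mono hKU).aestronglyMeasurable hKm
    have hguKm : AEStronglyMeasurable (fun x => g (u x)) (volume.restrict K) :=
      (hgu.mono hKU).aestronglyMeasurable hKm
    have hg'uKm : AEStronglyMeasurable (fun x => g' (u x)) (volume.restrict K) :=
      (hg'u.mono hKU).aestronglyMeasurable hKm
    have hm1 : AEStronglyMeasurable (fun x => (g (w k x) - g (u x)) • gradient η x)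
        (volume.restrict K) :=
      ((hgc.comp hwc).aestronglyMeasurable.sub hguKm).smul hdηc.aestronglyMeasurable
    have hm2 : AEStronglyMeasurable (fun x => (η x * g' (w k x)) • (gradient (w k) x - Du x))
        (volume.restrict K) :=
      (hηc.mul (hg'.comp hwc)).aestronglyMeasurable.smul
        ((continuous_gradient (hw1 k)).aestronglyMeasurable.sub hDuK.1)
    have hm3 : AEStronglyMeasurable (fun x => (g' (w k x) - g' (u x)) • (η x • Du x))
        (volume.restrict K) :=
      ((hg'.comp hwc).aestronglyMeasurable.sub hg'uKm).smul hηDu.1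
    -- The first and third terms pair a uniformly small factor with a fixed `L²` field. In the
    -- second, the factor is bounded and the gradients of the mollifications converge in `L²` on
    -- `K`.
    have hdec : (fun x => gradient (V k) x - Dv x)
        = ((fun x => (g (w k x) - g (u x)) • gradient η x)
          + (fun x => (η x * g' (w k x)) • (gradient (w k) x - Du x)))
          + (fun x => (g' (w k x) - g' (u x)) • (η x • Du x)) := by
      ext1 x
      simp only [hgradV, hDvdef, Pi.add_apply]
      module
    rw [hdec]
    refine (eLpNorm_add_le (hm1.add hm2) hm3 (by norm_num)).trans ?_
    gcongr
    refine (eLpNorm_add_le hm1 hm2 (by norm_num)).trans ?_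
    gcongr
    refine eLpNorm_le_mul_eLpNorm_of_ae_le_mul ?_ 2
    filter_upwards [ae_restrict_mem hKm] with x hx
    rw [norm_smul, norm_mul]
    gcongr
    · exact hCη x
    · refine hCg' _ ?_
      have h1 := hM x hx
      have h2 := hk x hx
      rw [Real.dist_eq, abs_sub_comm] at h2
      have := abs_add_le (u x) (w k x - u x)
      rw [add_sub_cancel] at this
      linarith
  exact (IsW12.of_tendsto (fun k => isW12_of_contDiff (hVc k) (hVt k)) hvm hDvm hlim
    hDlim).isW12Zero_of_support_subset hU hK hKU hvs hDvs

end ChainRule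

/-! ### Sobolev inequality on sets of small measure -/

section Sobolev

variable {n : ℕ}

theorem enorm_le_lintegral_fderiv_of_one {w : EuclideanSpace ℝ (Fin 1) → ℝ} (hw : ContDiff ℝ 1 w)
    (hc : HasCompactSupport w) (x : EuclideanSpace ℝ (Fin 1)) :
    ‖w x‖ₑ ≤ ∫⁻ y, ‖fderiv ℝ w y‖ₑ := by
  let E := EuclideanSpace ℝ (Fin 1)
  let e : ℝ ≃ᵐ E := (MeasurableEquiv.funUnique (Fin 1) ℝ).symm.trans
    (MeasurableEquiv.toLp 2 (Fin 1 → ℝ))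
  have he : MeasurePreserving e volume volume :=
    ((EuclideanSpace.volume_preserving_symm_measurableEquiv_toLp (Fin 1)).symm).comp
      ((volume_preserving_funUnique (Fin 1) ℝ).symm)
  have hlin : ∀ t, e t = EuclideanSpace.single 0 t := by
    intro t
    ext i
    fin_cases i
    rfl
  have hd : ∀ t, HasDerivAt e (EuclideanSpace.single 0 1) t := by
    intro t
    have h1 : HasDerivAt (fun t : ℝ => t • (EuclideanSpace.single 0 1 : E))
        ((1 : ℝ) • EuclideanSpace.single 0 1) t := (hasDerivAt_id t).smul_const _
    rw [one_smul] at h1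
    refine h1.congr_of_eventuallyEq (Eventually.of_forall fun s => ?_)
    rw [hlin]
    ext i
    simp
  have hiso : Isometry e := by
    refine Isometry.of_dist_eq fun s t => ?_
    rw [hlin, hlin, PiLp.dist_single_same]
  have hcd : ContDiff ℝ 1 e := by
    rw [show (e : ℝ → E) = fun t : ℝ => t • (EuclideanSpace.single 0 1 : E) from by
      ext t i
      simp [hlin]]
    fun_prop
  have h1 := HasCompactSupport.enorm_le_lintegral_Ici_deriv (f := w ∘ e) (hw.comp hcd)
    (hc.comp_isClosedEmbedding hiso.isClosedEmbedding) (e.symm x)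
  simp only [Function.comp_apply, MeasurableEquiv.apply_symm_apply] at h1
  refine h1.trans ((setLIntegral_le_lintegral _ _).trans ?_)
  rw [← he.lintegral_comp_emb e.measurableEmbedding]
  refine lintegral_mono fun t => ?_
  have h2 : HasDerivAt (w ∘ e) (fderiv ℝ w (e t) (EuclideanSpace.single 0 1)) t :=
    ((hw.differentiable one_ne_zero) (e t)).hasFDerivAt.comp_hasDerivAt t (hd t)
  rw [h2.deriv]
  refine (ContinuousLinearMap.le_opENorm _ _).trans (le_of_eq ?_)
  rw [← ofReal_norm (EuclideanSpace.single (0 : Fin 1) (1 : ℝ))]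
  simp

/-- For `n ≥ 2` this is the Gagliardo–Nirenberg–Sobolev embedding of `W^{1,1}` into `L^{n/(n-1)}`,
followed by Hölder on `A`. For `n = 1` the exponent degenerates, and the supremum bound from the
fundamental theorem of calculus takes its place. -/
theorem exists_setLIntegral_enorm_le (hn : 1 ≤ n) :
    ∃ C : NNReal, ∀ (w : EuclideanSpace ℝ (Fin n) → ℝ), ContDiff ℝ 1 w → HasCompactSupport w →
      ∀ A : Set (EuclideanSpace ℝ (Fin n)),
      ∫⁻ x in A, ‖w x‖ₑ ≤ C * volume A ^ (1 / n : ℝ) * ∫⁻ x, ‖fderiv ℝ w x‖ₑ := by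
  rcases hn.eq_or_lt with rfl | hn
  · refine ⟨1, fun w hw hc A => ?_⟩
    calc ∫⁻ x in A, ‖w x‖ₑ ≤ ∫⁻ _x in A, ∫⁻ y, ‖fderiv ℝ w y‖ₑ :=
          lintegral_mono fun x => enorm_le_lintegral_fderiv_of_one hw hc x
      _ = _ := by simp [mul_comm]
  · have hn1 : (1 : ℝ) < n := by exact_mod_cast hn
    let p : NNReal := (n : NNReal) / (n - 1)
    have hfr : Module.finrank ℝ (EuclideanSpace ℝ (Fin n)) = n := by simp
    have hp : NNReal.HolderConjugate (n : NNReal) p := by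
      refine NNReal.HolderConjugate.conjExponent ?_
      exact_mod_cast hn
    have hp' : NNReal.HolderConjugate
        (Module.finrank ℝ (EuclideanSpace ℝ (Fin n)) : NNReal) p := by rw [hfr]; exact hp
    refine ⟨eLpNormLESNormFDerivOneConst (volume : Measure (EuclideanSpace ℝ (Fin n))) p,
      fun w hw hc A => ?_⟩
    have h1 := eLpNorm_le_eLpNorm_fderiv_one (volume : Measure (EuclideanSpace ℝ (Fin n)))
      hw hc hp'
    have h2 := eLpNorm_le_eLpNorm_mul_rpow_measure_univ (μ := volume.restrict A) (p := 1)
      (q := (p : ENNReal)) (f := w) (by exact_mod_cast hp.symm.lt.le)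
      hw.continuous.aestronglyMeasurable
    rw [eLpNorm_one_eq_lintegral_enorm, Measure.restrict_apply_univ] at h2
    rw [eLpNorm_one_eq_lintegral_enorm] at h1
    have hexp : (1 / (1 : ENNReal).toReal - 1 / (p : ENNReal).toReal) = (1 / n : ℝ) := by
      have := hp.coe.inv_add_inv_eq_one
      simp only [NNReal.coe_natCast] at this
      simp only [ENNReal.toReal_one, ENNReal.coe_toReal, one_div, inv_one]
      linarith
    rw [hexp] at h2
    calc _ ≤ _ := h2
      _ ≤ _ := by
        rw [mul_right_comm]
        gcongr
        exact (eLpNorm_mono_measure _ Measure.restrict_le_self).trans h1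

/-- The `L¹` inequality is applied to `w²`, with `|D(w²)| = 2 |w| |Dw|` and Cauchy–Schwarz. This
treats all dimensions at once, including `n = 2`, where the critical exponent for `L²` gradients is
infinite. The set `A` is not tied to the support of `w`, because smooth approximants need not vanish
off `A`. -/
theorem exists_eLpNorm_restrict_sq_le (hn : 1 ≤ n) :
    ∃ C : NNReal, ∀ (w : EuclideanSpace ℝ (Fin n) → ℝ), ContDiff ℝ 1 w → HasCompactSupport w →
      ∀ A : Set (EuclideanSpace ℝ (Fin n)),
      eLpNorm w 2 (volume.restrict A) ^ 2 ≤ C * volume A ^ (1 / n : ℝ) *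
        (eLpNorm w 2 volume * eLpNorm (gradient w) 2 volume) := by
  obtain ⟨C, hC⟩ := exists_setLIntegral_enorm_le hn
  refine ⟨C * 2, fun w hw hc A => ?_⟩
  have h1 := hC (fun x => w x ^ 2) (hw.pow 2) (hc.comp_left (g := fun s => s ^ 2) (by simp)) A
  have hsq : eLpNorm w 2 (volume.restrict A) ^ 2 = ∫⁻ x in A, ‖w x ^ 2‖ₑ := by
    have := eLpNorm_nnreal_pow_eq_lintegral (f := w) (μ := volume.restrict A)
      (p := 2) (by norm_num)
    simpa using this
  have hd : ∀ x, ‖fderiv ℝ (fun x => w x ^ 2) x‖ₑ = 2 * ‖w x • gradient w x‖ₑ := by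
    intro x
    have h2 := ((hw.differentiable one_ne_zero) x).hasFDerivAt.pow 2
    rw [h2.fderiv]
    have h3 : ‖gradient w x‖ₑ = ‖fderiv ℝ w x‖ₑ := by
      rw [← ofReal_norm, ← ofReal_norm, norm_gradient_eq]
    have h4 : ‖(2 : ℝ)‖ₑ = 2 := by rw [Real.enorm_eq_ofReal (by norm_num)]; norm_num
    simp [enorm_smul, h3, enorm_mul, mul_assoc, h4]
  have h4 : ∫⁻ x, ‖fderiv ℝ (fun x => w x ^ 2) x‖ₑ
      ≤ 2 * (eLpNorm w 2 volume * eLpNorm (gradient w) 2 volume) := by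
    simp_rw [hd]
    rw [lintegral_const_mul' _ _ (by norm_num)]
    gcongr
    have := eLpNorm_smul_le_mul_eLpNorm (p := 2) (q := 2) (r := 1) (μ := volume)
      (continuous_gradient hw).aestronglyMeasurable hw.continuous.aestronglyMeasurable
    rw [eLpNorm_one_eq_lintegral_enorm] at this
    exact this
  rw [hsq]
  refine h1.trans ?_
  calc _ ≤ C * volume A ^ (1 / n : ℝ) * (2 * (eLpNorm w 2 volume * eLpNorm (gradient w) 2 volume)) := by
        gcongr
    _ = _ := by push_cast; ring

theorem tendsto_eLpNorm_of_tendsto_eLpNorm_sub {X F : Type*} [MeasurableSpace X]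
    [NormedAddCommGroup F] {μ : Measure X} {f : X → F} {w : ℕ → X → F} (hf : MemLp f 2 μ)
    (hw : ∀ k, AEStronglyMeasurable (w k) μ)
    (hlim : Tendsto (fun k => eLpNorm (fun x => w k x - f x) 2 μ) atTop (𝓝 0)) :
    Tendsto (fun k => eLpNorm (w k) 2 μ) atTop (𝓝 (eLpNorm f 2 μ)) := by
  have h1 : Tendsto (fun k => eLpNorm f 2 μ - eLpNorm (fun x => w k x - f x) 2 μ) atTop
      (𝓝 (eLpNorm f 2 μ)) := by
    simpa using ENNReal.Tendsto.sub (tendsto_const_nhds (x := eLpNorm f 2 μ)) hlim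
      (Or.inl hf.2.ne)
  have h2 : Tendsto (fun k => eLpNorm f 2 μ + eLpNorm (fun x => w k x - f x) 2 μ) atTop
      (𝓝 (eLpNorm f 2 μ)) := by
    simpa using (tendsto_const_nhds (x := eLpNorm f 2 μ)).add hlim
  refine tendsto_of_tendsto_of_tendsto_of_le_of_le h1 h2 (fun k => ?_) (fun k => ?_)
  · rw [tsub_le_iff_right]
    have := eLpNorm_sub_le (hw k) ((hw k).sub hf.1) (by norm_num : (1 : ENNReal) ≤ 2)
    rw [sub_sub_cancel] at this
    exact this
  · have := eLpNorm_add_le hf.1 ((hw k).sub hf.1) (by norm_num : (1 : ENNReal) ≤ 2)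
    rw [add_sub_cancel] at this
    exact this

/-- A Sobolev inequality with gain, for functions of `W_0^{1,2}` supported in a small set. -/
theorem exists_integral_sq_le_of_isW12Zero (hn : 1 ≤ n) :
    ∃ C : ℝ, 0 < C ∧ ∀ (U A : Set (EuclideanSpace ℝ (Fin n))), IsOpen U → MeasurableSet A →
      A ⊆ U → volume A ≠ ⊤ → ∀ (φ : EuclideanSpace ℝ (Fin n) → ℝ)
      (Dφ : EuclideanSpace ℝ (Fin n) → EuclideanSpace ℝ (Fin n)), IsW12Zero U φ Dφ →
      (∀ x ∈ U, x ∉ A → φ x = 0) →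
      ∫ x in U, φ x ^ 2 ≤ C * volume.real A ^ (2 / n : ℝ) * ∫ x in U, ‖Dφ x‖ ^ 2 := by
  obtain ⟨C, hC⟩ := exists_eLpNorm_restrict_sq_le hn
  -- The summand `1` only makes the constant positive, since `C` may vanish.
  refine ⟨C ^ 2 + 1, by positivity, fun U A hU hA hAU hAfin φ Dφ h hφA => ?_⟩
  obtain ⟨ψ, hψ, hψ1, hψ2⟩ := h.approx
  have hX : eLpNorm φ 2 (volume.restrict A) = eLpNorm φ 2 (volume.restrict U) := by
    rw [← eLpNorm_indicator_eq_eLpNorm_restrict hA, ← eLpNorm_indicator_eq_eLpNorm_restrict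
      hU.measurableSet]
    congr 1
    ext x
    by_cases hxA : x ∈ A
    · simp [hxA, hAU hxA]
    · by_cases hxU : x ∈ U
      · simp [hxA, hxU, hφA x hxU hxA]
      · simp [hxA, hxU]
  have hmA : volume.restrict A ≤ volume.restrict U := Measure.restrict_mono hAU le_rfl
  have hφAm : MemLp φ 2 (volume.restrict A) := h.isW12.memLp.mono_measure hmA
  have t1 : Tendsto (fun k => eLpNorm (ψ k) 2 (volume.restrict A)) atTop
      (𝓝 (eLpNorm φ 2 (volume.restrict A))) := by
    refine tendsto_eLpNorm_of_tendsto_eLpNorm_sub hφAm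
      (fun k => (hψ k).smooth.continuous.aestronglyMeasurable) ?_
    exact tendsto_of_tendsto_of_tendsto_of_le_of_le tendsto_const_nhds hψ1
      (fun _ => zero_le) fun k => eLpNorm_mono_measure _ hmA
  have t2 : Tendsto (fun k => eLpNorm (ψ k) 2 (volume.restrict U)) atTop
      (𝓝 (eLpNorm φ 2 (volume.restrict U))) :=
    tendsto_eLpNorm_of_tendsto_eLpNorm_sub h.isW12.memLp
      (fun k => (hψ k).smooth.continuous.aestronglyMeasurable) hψ1
  have t3 : Tendsto (fun k => eLpNorm (gradient (ψ k)) 2 (volume.restrict U)) atTop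
      (𝓝 (eLpNorm Dφ 2 (volume.restrict U))) :=
    tendsto_eLpNorm_of_tendsto_eLpNorm_sub h.isW12.memLp_grad
      (fun k => (continuous_gradient (hψ k).contDiff_one).aestronglyMeasurable) hψ2
  have hV : volume A ^ (1 / n : ℝ) ≠ ⊤ := ENNReal.rpow_ne_top_of_nonneg (by positivity) hAfin
  have key : eLpNorm φ 2 (volume.restrict A) ^ 2 ≤ C * volume A ^ (1 / n : ℝ) *
      (eLpNorm φ 2 (volume.restrict U) * eLpNorm Dφ 2 (volume.restrict U)) := by
    refine le_of_tendsto_of_tendsto' ((ENNReal.continuous_pow 2).tendsto _ |>.comp t1)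
      (ENNReal.Tendsto.const_mul
      (ENNReal.Tendsto.mul t2 (Or.inr h.isW12.memLp_grad.2.ne) t3 (Or.inr h.isW12.memLp.2.ne))
      (Or.inr (ENNReal.mul_ne_top ENNReal.coe_ne_top hV))) fun k => ?_
    refine (hC (ψ k) (hψ k).contDiff_one (hψ k).compact_support A).trans (le_of_eq ?_)
    rw [eLpNorm_restrict_eq_of_support_subset
        ((subset_tsupport _).trans (hψ k).support_subset),
      eLpNorm_restrict_eq_of_support_subset
        ((support_gradient_subset _).trans (hψ k).support_subset)]
  rw [hX] at key
  set X := (eLpNorm φ 2 (volume.restrict U)).toReal with hXd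
  set Y := (eLpNorm Dφ 2 (volume.restrict U)).toReal with hYd
  have keyR : X ^ 2 ≤ C * volume.real A ^ (1 / n : ℝ) * (X * Y) := by
    have := ENNReal.toReal_mono (ENNReal.mul_ne_top (ENNReal.mul_ne_top ENNReal.coe_ne_top hV)
      (ENNReal.mul_ne_top h.isW12.memLp.2.ne h.isW12.memLp_grad.2.ne)) key
    simpa [ENNReal.toReal_pow, ENNReal.toReal_mul, ENNReal.toReal_rpow, measureReal_def] using this
  have hX0 : 0 ≤ X := ENNReal.toReal_nonneg
  have hY0 : 0 ≤ Y := ENNReal.toReal_nonneg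
  -- In the limit the norms over `A` and `U` coincide, so one factor `X` cancels; squaring then
  -- doubles the exponent `1 / n`.
  have hXY : X ≤ C * volume.real A ^ (1 / n : ℝ) * Y := by
    rcases hX0.eq_or_lt with h0 | h0
    · rw [← h0]; positivity
    · refine le_of_mul_le_mul_left ?_ h0
      calc X * X = X ^ 2 := by ring
        _ ≤ _ := keyR
        _ = _ := by ring
  have hsqrt : ∀ a : ℝ, a ^ (2 : ℝ)⁻¹ = √a := fun a => by rw [Real.sqrt_eq_rpow, one_div]
  have hXi : ∫ x in U, φ x ^ 2 = X ^ 2 := by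
    have := h.isW12.memLp.eLpNorm_eq_integral_rpow_norm (by norm_num) (by norm_num)
    rw [hXd, this, ENNReal.toReal_ofReal (by positivity)]
    simp only [ENNReal.toReal_ofNat, Real.rpow_ofNat, Real.norm_eq_abs, sq_abs]
    rw [hsqrt, Real.sq_sqrt (integral_nonneg fun x => sq_nonneg _)]
  have hYi : ∫ x in U, ‖Dφ x‖ ^ 2 = Y ^ 2 := by
    have := h.isW12.memLp_grad.eLpNorm_eq_integral_rpow_norm (by norm_num) (by norm_num)
    rw [hYd, this, ENNReal.toReal_ofReal (by positivity)]
    simp only [ENNReal.toReal_ofNat, Real.rpow_ofNat]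
    rw [hsqrt, Real.sq_sqrt (integral_nonneg fun x => sq_nonneg _)]
  have hA2 : volume.real A ^ (2 / n : ℝ) = (volume.real A ^ (1 / n : ℝ)) ^ 2 := by
    rw [← Real.rpow_mul_natCast measureReal_nonneg]
    congr 1
    push_cast; ring
  rw [hXi, hYi, hA2]
  calc X ^ 2 ≤ (C * volume.real A ^ (1 / n : ℝ) * Y) ^ 2 := by gcongr
    _ = C ^ 2 * (volume.real A ^ (1 / n : ℝ)) ^ 2 * Y ^ 2 := by ring
    _ ≤ _ := by gcongr; linarith

end Sobolev

/-! ### Caccioppoli inequality -/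

section Caccioppoli

variable {n : ℕ}

theorem matAct_add_smul (A : Matrix (Fin n) (Fin n) ℝ) (a b : ℝ) (ξ ζ : EuclideanSpace ℝ (Fin n)) :
    matAct A (a • ξ + b • ζ) = a • matAct A ξ + b • matAct A ζ := by
  simp [matAct, Matrix.mulVec_add, Matrix.mulVec_smul]

theorem inner_matAct_comm {A : Matrix (Fin n) (Fin n) ℝ} (hA : A.IsSymm)
    (ξ ζ : EuclideanSpace ℝ (Fin n)) :
    inner ℝ (matAct A ξ) ζ = inner ℝ (matAct A ζ) ξ := by
  simp only [matAct, EuclideanSpace.inner_eq_star_dotProduct, star_trivial]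
  rw [dotProduct_comm, Matrix.dotProduct_mulVec, ← Matrix.mulVec_transpose, hA.eq,
    dotProduct_comm]

/-- Young's inequality for the quadratic form of a positive semidefinite matrix. -/
theorem abs_two_mul_inner_matAct_le {A : Matrix (Fin n) (Fin n) ℝ} (hA : A.IsSymm)
    (hpos : ∀ ξ, 0 ≤ inner ℝ (matAct A ξ) ξ) (a b : ℝ) (ξ ζ : EuclideanSpace ℝ (Fin n)) :
    |2 * (a * b) * inner ℝ (matAct A ξ) ζ|
      ≤ a ^ 2 * inner ℝ (matAct A ξ) ξ + b ^ 2 * inner ℝ (matAct A ζ) ζ := by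
  have key : ∀ c : ℝ, 0 ≤ a ^ 2 * inner ℝ (matAct A ξ) ξ
      + 2 * (a * c) * inner ℝ (matAct A ξ) ζ + c ^ 2 * inner ℝ (matAct A ζ) ζ := by
    intro c
    have h := hpos (a • ξ + c • ζ)
    rw [matAct_add_smul] at h
    simp only [inner_add_left, inner_add_right, real_inner_smul_left, real_inner_smul_right] at h
    rw [inner_matAct_comm hA ζ ξ] at h
    linarith
  rw [abs_le]
  have h1 := key b
  have h2 := key (-b)
  constructor <;> linarith

/-- The square of the positive part is `C¹` even at the kink, which makes the chain rule applicable
to truncations. -/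
theorem hasDerivAt_max_sq (k s : ℝ) :
    HasDerivAt (fun s => (max (s - k) 0) ^ 2) (2 * max (s - k) 0) s := by
  have h0 : (fun s => (max (s - k) 0) ^ 2) = fun s => ((s - k) * |s - k| + (s - k) ^ 2) / 2 := by
    ext t
    rcases le_total (t - k) 0 with h | h
    · rw [max_eq_right h, abs_of_nonpos h]; ring
    · rw [max_eq_left h, abs_of_nonneg h]; ring
  rw [h0]
  have habs : HasDerivAt (fun t : ℝ => t * |t|) (2 * |s - k|) (s - k) := by
    rcases lt_trichotomy (s - k) 0 with h | h | h
    · have h1 : HasDerivAt (fun t : ℝ => -(t * t)) (2 * |s - k|) (s - k) := by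
        refine (((hasDerivAt_id (s - k)).mul (hasDerivAt_id (s - k))).neg).congr_deriv ?_
        rw [abs_of_neg h]; simp; ring
      refine h1.congr_of_eventuallyEq ?_
      filter_upwards [eventually_lt_nhds h] with t ht
      rw [abs_of_neg ht]; ring
    · rw [h, abs_zero, mul_zero, hasDerivAt_iff_tendsto_slope]
      have h2 : Tendsto (fun t : ℝ => |t|) (𝓝[≠] 0) (𝓝 0) := by
        have := (continuous_abs (G := ℝ)).tendsto 0
        rw [abs_zero] at this
        exact this.mono_left nhdsWithin_le_nhds
      refine h2.congr' ?_
      filter_upwards [self_mem_nhdsWithin] with t ht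
      have ht' : t ≠ 0 := ht
      rw [slope_def_field]
      field_simp
      simp
    · have h1 : HasDerivAt (fun t : ℝ => t * t) (2 * |s - k|) (s - k) := by
        refine ((hasDerivAt_id (s - k)).mul (hasDerivAt_id (s - k))).congr_deriv ?_
        rw [abs_of_pos h]; simp; ring
      refine h1.congr_of_eventuallyEq ?_
      filter_upwards [eventually_gt_nhds h] with t ht
      rw [abs_of_pos ht]
  have hs : HasDerivAt (fun t : ℝ => t - k) 1 s := (hasDerivAt_id s).sub_const k
  have h3 := (habs.comp s hs).add (hs.pow 2)
  refine (h3.div_const 2).congr_deriv ?_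
  rcases le_total (s - k) 0 with h | h
  · rw [max_eq_right h, abs_of_nonpos h]; ring
  · rw [max_eq_left h, abs_of_nonneg h]; ring

theorem hasDerivAt_max_cube (k s : ℝ) :
    HasDerivAt (fun s => (max (s - k) 0) ^ 3) (3 * max (s - k) 0 ^ 2) s := by
  have h0 : (fun s => (max (s - k) 0) ^ 3) = fun s => (max (s - k) 0) ^ 2 * (s - k) := by
    ext t
    rcases le_total (t - k) 0 with h | h
    · rw [max_eq_right h]; ring
    · rw [max_eq_left h]; ring
  rw [h0]
  refine ((hasDerivAt_max_sq k s).mul ((hasDerivAt_id s).sub_const k)).congr_deriv ?_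
  simp only [id]
  rcases le_total (s - k) 0 with h | h
  · rw [max_eq_right h]; ring
  · rw [max_eq_left h]; ring

theorem IsTestFunction.exists_bound {U : Set (EuclideanSpace ℝ (Fin n))}
    {η q : EuclideanSpace ℝ (Fin n) → ℝ} (hη : IsTestFunction U η) (hq : ContinuousOn q U) :
    ∃ C : ℝ, 0 ≤ C ∧ ∀ x ∈ tsupport η, |q x| ≤ C := by
  obtain ⟨C, hC⟩ := hη.compact_support.exists_bound_of_continuousOn (hq.mono hη.support_subset)
  exact ⟨|C|, abs_nonneg C, fun x hx => (hC x hx).trans (le_abs_self C)⟩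

theorem IsTestFunction.memLp_mul_smul {U : Set (EuclideanSpace ℝ (Fin n))} (hU : IsOpen U)
    {η q : EuclideanSpace ℝ (Fin n) → ℝ} (hη : IsTestFunction U η) (hq : ContinuousOn q U)
    {h : EuclideanSpace ℝ (Fin n) → EuclideanSpace ℝ (Fin n)}
    (hh : MemLp h 2 (volume.restrict U)) :
    MemLp (fun x => (η x * q x) • h x) 2 (volume.restrict U) := by
  obtain ⟨C, hC0, hC⟩ := hη.exists_bound (hη.smooth.continuous.continuousOn.mul hq)
  refine hh.of_le_mul (c := C) ?_ (ae_of_all _ fun x => ?_)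
  · exact ((hη.smooth.continuous.continuousOn.mul hq).aestronglyMeasurable hU.measurableSet).smul
      hh.1
  · rw [norm_smul]
    by_cases hx : x ∈ tsupport η
    · gcongr
      exact hC x hx
    · rw [image_eq_zero_of_notMem_tsupport hx, zero_mul, norm_zero, zero_mul]
      positivity

theorem IsTestFunction.memLp_smul_gradient {U : Set (EuclideanSpace ℝ (Fin n))} (hU : IsOpen U)
    {η q : EuclideanSpace ℝ (Fin n) → ℝ} (hη : IsTestFunction U η) (hq : ContinuousOn q U) :
    MemLp (fun x => q x • gradient η x) 2 (volume.restrict U) := by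
  obtain ⟨C, hC0, hC⟩ := hη.exists_bound hq
  refine (hη.memLp_gradient 2 (volume.restrict U)).of_le_mul (c := C) ?_ (ae_of_all _ fun x => ?_)
  · exact (hq.smul (continuous_gradient hη.contDiff_one).continuousOn).aestronglyMeasurable
      hU.measurableSet
  · rw [norm_smul]
    by_cases hx : x ∈ tsupport η
    · gcongr
      exact hC x hx
    · have : gradient η x = 0 := by_contra fun h0 => hx (support_gradient_subset η h0)
      simp [this]

theorem IsTestFunction.sq {U : Set (EuclideanSpace ℝ (Fin n))}
    {η : EuclideanSpace ℝ (Fin n) → ℝ} (hη : IsTestFunction U η) :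
    IsTestFunction U (fun x => η x ^ 2) where
  smooth := hη.smooth.pow 2
  compact_support := hη.compact_support.comp_left (g := fun s => s ^ 2) (by simp)
  support_subset := by
    refine (closure_mono ?_).trans hη.support_subset
    intro x hx h0
    exact hx (by simp [h0])

theorem gradient_sq {η : EuclideanSpace ℝ (Fin n) → ℝ} {x : EuclideanSpace ℝ (Fin n)}
    (hη : DifferentiableAt ℝ η x) :
    gradient (fun y => η y ^ 2) x = (2 * η x) • gradient η x := by
  apply HasGradientAt.gradient
  rw [hasGradientAt_iff_hasFDerivAt]
  refine (hη.hasFDerivAt.pow 2).congr_fderiv ?_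
  ext y
  simp [gradient]

theorem IsUniformlyElliptic.integrable_inner {lam Lam : ℝ} (hlam : 0 < lam)
    {U : Set (EuclideanSpace ℝ (Fin n))}
    {A : EuclideanSpace ℝ (Fin n) → Matrix (Fin n) (Fin n) ℝ} (hA : IsUniformlyElliptic lam Lam U A)
    {V W : EuclideanSpace ℝ (Fin n) → EuclideanSpace ℝ (Fin n)}
    (hV : MemLp V 2 (volume.restrict U)) (hW : MemLp W 2 (volume.restrict U)) :
    IntegrableOn (fun x => inner ℝ (matAct (A x) (V x)) (W x)) U := by
  have hdom : IntegrableOn (fun x => Lam / 2 * (‖V x‖ ^ 2 + ‖W x‖ ^ 2)) U :=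
    ((hV.integrable_norm_pow (by norm_num)).add (hW.integrable_norm_pow (by norm_num))).const_mul _
  refine hdom.mono' ?_ ?_
  · have hVi : ∀ i, AEMeasurable (fun x => V x i) (volume.restrict U) := fun i =>
      (memLp_coord hV i).1.aemeasurable
    have hWi : ∀ i, AEMeasurable (fun x => W x i) (volume.restrict U) := fun i =>
      (memLp_coord hW i).1.aemeasurable
    have : (fun x => inner ℝ (matAct (A x) (V x)) (W x))
        = fun x => ∑ i, W x i * ∑ j, A x i j * V x j := by
      ext x
      simp [matAct, PiLp.inner_apply, Matrix.mulVec, dotProduct]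
    rw [this]
    refine AEMeasurable.aestronglyMeasurable ?_
    refine Finset.aemeasurable_fun_sum _ fun i _ => (hWi i).mul ?_
    exact Finset.aemeasurable_fun_sum _ fun j _ => (hA.aemeasurable i j).mul (hVi j)
  · filter_upwards [hA.symm, hA.elliptic] with x hs he
    have h1 := abs_two_mul_inner_matAct_le hs
      (fun ξ => (mul_nonneg hlam.le (sq_nonneg _)).trans (he ξ).1) 1 1 (V x) (W x)
    rw [abs_mul] at h1
    norm_num at h1
    rw [Real.norm_eq_abs]
    linarith [(he (V x)).2, (he (W x)).2]

/-- The weak formulation of `div (A Du) ≥ f(u)`, for a given weak gradient `Du`. -/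
def IsSubsolutionGrad (A : EuclideanSpace ℝ (Fin n) → Matrix (Fin n) (Fin n) ℝ) (f : ℝ → ℝ)
    (U : Set (EuclideanSpace ℝ (Fin n))) (u : EuclideanSpace ℝ (Fin n) → ℝ)
    (Du : EuclideanSpace ℝ (Fin n) → EuclideanSpace ℝ (Fin n)) : Prop :=
  ∀ (φ : EuclideanSpace ℝ (Fin n) → ℝ)
    (Dφ : EuclideanSpace ℝ (Fin n) → EuclideanSpace ℝ (Fin n)),
    IsW12Zero U φ Dφ → (∀ᵐ x ∂(volume.restrict U), 0 ≤ φ x) →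
    IntegrableOn (fun x => f (u x) * φ x) U ∧
    ∫ x in U, inner ℝ (matAct (A x) (Du x)) (Dφ x) ≤ -∫ x in U, f (u x) * φ x

/-- A Caccioppoli inequality for truncations of subsolutions. -/
theorem caccioppoli {lam Lam : ℝ} (hlam : 0 < lam) {U : Set (EuclideanSpace ℝ (Fin n))}
    (hU : IsOpen U) {A : EuclideanSpace ℝ (Fin n) → Matrix (Fin n) (Fin n) ℝ}
    (hA : IsUniformlyElliptic lam Lam U A) {f : ℝ → ℝ}
    {u : EuclideanSpace ℝ (Fin n) → ℝ} (hu : ContinuousOn u U)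
    {Du : EuclideanSpace ℝ (Fin n) → EuclideanSpace ℝ (Fin n)} (hDu : IsW12 U u Du)
    (hsub : IsSubsolutionGrad A f U u Du)
    {η : EuclideanSpace ℝ (Fin n) → ℝ} (hη : IsTestFunction U η) (k : ℝ) :
    IntegrableOn (fun x => f (u x) * (η x ^ 2 * max (u x - k) 0 ^ 3)) U ∧
    (∫ x in U, f (u x) * (η x ^ 2 * max (u x - k) 0 ^ 3))
      + 2 * lam * ∫ x in U, ‖(η x * max (u x - k) 0) • Du x‖ ^ 2
      ≤ Lam * ∫ x in U, ‖max (u x - k) 0 ^ 2 • gradient η x‖ ^ 2 := by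
  set v : EuclideanSpace ℝ (Fin n) → ℝ := fun x => max (u x - k) 0 with hv
  have hvc : ContinuousOn v U := (hu.sub continuousOn_const).sup continuousOn_const
  have hv0 : ∀ x, 0 ≤ v x := fun x => le_max_right _ _
  -- The test function is `η² (u - k)₊³`.
  have hφ := hDu.isW12Zero_mul_comp hU hu hη.sq (g := fun s => (max (s - k) 0) ^ 3)
    (g' := fun s => 3 * max (s - k) 0 ^ 2) (hasDerivAt_max_cube k) (by fun_prop)
  obtain ⟨hint, hle⟩ := hsub _ _ hφ (ae_of_all _ fun x => by have := hv0 x; positivity)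
  refine ⟨hint, ?_⟩
  have hm1 := hη.memLp_mul_smul hU hvc hDu.memLp_grad
  have hm2 := hη.memLp_smul_gradient hU (q := fun x => v x ^ 2) (hvc.pow 2)
  have hi1 := hm1.integrable_norm_pow (by norm_num)
  have hi2 := hm2.integrable_norm_pow (by norm_num)
  have hlow : ∫ x in U, (2 * lam * ‖(η x * v x) • Du x‖ ^ 2 - Lam * ‖v x ^ 2 • gradient η x‖ ^ 2)
      ≤ ∫ x in U, inner ℝ (matAct (A x) (Du x))
        (v x ^ 3 • gradient (fun x => η x ^ 2) x + (η x ^ 2 * (3 * v x ^ 2)) • Du x) := by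
    refine integral_mono_ae ((hi1.const_mul _).sub (hi2.const_mul _))
      (hA.integrable_inner hlam hDu.memLp_grad hφ.isW12.memLp_grad) ?_
    filter_upwards [hA.symm, hA.elliptic] with x hs he
    -- The integrand is `3 η² v² ⟨A Du, Du⟩ + 2 η v³ ⟨A Du, Dη⟩`. Young with weights `η v` and `v²`
    -- absorbs one of the three copies of the first term and leaves two.
    have h1 := abs_two_mul_inner_matAct_le hs
      (fun ξ => (mul_nonneg hlam.le (sq_nonneg _)).trans (he ξ).1) (η x * v x) (v x ^ 2)
      (Du x) (gradient η x)
    have h2 := (abs_le.1 h1).1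
    rw [gradient_sq (hη.contDiff_one.differentiable one_ne_zero x)]
    simp only [inner_add_right, real_inner_smul_right, norm_smul, mul_pow, Real.norm_eq_abs,
      sq_abs]
    have h3 := mul_le_mul_of_nonneg_left (he (Du x)).1 (sq_nonneg (η x * v x))
    have h4 := mul_le_mul_of_nonneg_left (he (gradient η x)).2 (sq_nonneg (v x ^ 2))
    nlinarith [h2, h3, h4]
  rw [integral_sub (hi1.const_mul _) (hi2.const_mul _), integral_const_mul,
    integral_const_mul] at hlow
  have := hlow.trans hle
  linarith

end Caccioppoli

/-! ### Cutoffs and the energy estimate for truncations -/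

section DeGiorgi

variable {n : ℕ}

theorem exists_smoothTransition_deriv_bound :
    ∃ C : ℝ, 0 < C ∧ ∀ s, |deriv Real.smoothTransition s| ≤ C := by
  have hc : Continuous (deriv Real.smoothTransition) :=
    (Real.smoothTransition.contDiff (n := 1)).continuous_deriv le_rfl
  obtain ⟨C, hC⟩ := (isCompact_Icc (a := (0 : ℝ)) (b := 1)).exists_bound_of_continuousOn
    hc.continuousOn
  refine ⟨|C| + 1, by positivity, fun s => ?_⟩
  rcases lt_or_ge s 0 with hs | hs
  · have : deriv Real.smoothTransition s = 0 := by
      have h1 : Real.smoothTransition =ᶠ[𝓝 s] fun _ => 0 := by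
        filter_upwards [eventually_lt_nhds hs] with t ht
        exact Real.smoothTransition.zero_of_nonpos ht.le
      rw [h1.deriv_eq, deriv_const]
    rw [this, abs_zero]; positivity
  rcases lt_or_ge 1 s with hs1 | hs1
  · have : deriv Real.smoothTransition s = 0 := by
      have h1 : Real.smoothTransition =ᶠ[𝓝 s] fun _ => 1 := by
        filter_upwards [eventually_gt_nhds hs1] with t ht
        exact Real.smoothTransition.one_of_one_le ht.le
      rw [h1.deriv_eq, deriv_const]
    rw [this, abs_zero]; positivity
  · have := hC s ⟨hs, hs1⟩
    rw [Real.norm_eq_abs] at this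
    linarith [le_abs_self C]

/-- The smooth transition is composed with a quotient quadratic in `x - y`, hence smooth at the
center as well. Its gradient is at most `2 r / (r² - r'²) ≤ 2 / (r - r')` on the ball. -/
theorem exists_cutoff : ∃ C : ℝ, 0 < C ∧ ∀ (n : ℕ) (y : EuclideanSpace ℝ (Fin n)) (r' r : ℝ),
    0 < r' → r' < r → ∃ η : EuclideanSpace ℝ (Fin n) → ℝ,
      IsTestFunction Set.univ η ∧ tsupport η ⊆ Metric.closedBall y r ∧
      (∀ x ∈ Metric.closedBall y r', η x = 1) ∧ ∀ x, ‖gradient η x‖ ≤ C / (r - r') := by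
  obtain ⟨C, hC0, hC⟩ := exists_smoothTransition_deriv_bound
  refine ⟨2 * C, by positivity, fun n y r' r hr' hr => ?_⟩
  have hd : 0 < r - r' := by linarith
  have hD : 0 < r ^ 2 - r' ^ 2 := by nlinarith
  let q : EuclideanSpace ℝ (Fin n) → ℝ := fun x => (r ^ 2 - ‖x - y‖ ^ 2) / (r ^ 2 - r' ^ 2)
  have hq : ContDiff ℝ (⊤ : ℕ∞) q :=
    (contDiff_const.sub ((contDiff_id.sub contDiff_const).norm_sq ℝ)).div_const _
  have hsm : ContDiff ℝ (⊤ : ℕ∞) fun x => Real.smoothTransition (q x) :=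
    Real.smoothTransition.contDiff.comp hq
  have hts : tsupport (fun x => Real.smoothTransition (q x)) ⊆ Metric.closedBall y r := by
    refine closure_minimal ?_ Metric.isClosed_closedBall
    intro x hx
    by_contra h0
    apply hx
    rw [Metric.mem_closedBall, not_le, dist_eq_norm] at h0
    refine Real.smoothTransition.zero_of_nonpos (div_nonpos_of_nonpos_of_nonneg ?_ hD.le)
    nlinarith
  refine ⟨fun x => Real.smoothTransition (q x), ⟨hsm, ?_, Set.subset_univ _⟩, hts, ?_, ?_⟩
  · exact HasCompactSupport.of_support_subset_isCompact (isCompact_closedBall y r)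
      ((subset_tsupport _).trans hts)
  · intro x hx
    rw [Metric.mem_closedBall, dist_eq_norm] at hx
    refine Real.smoothTransition.one_of_one_le ?_
    rw [le_div_iff₀ hD]
    nlinarith [norm_nonneg (x - y)]
  · intro x
    by_cases hx : x ∈ Metric.closedBall y r
    swap
    · have : gradient (fun x => Real.smoothTransition (q x)) x = 0 :=
        by_contra fun h0 => hx (hts (support_gradient_subset _ h0))
      rw [this, norm_zero]; positivity
    rw [Metric.mem_closedBall, dist_eq_norm] at hx
    have hdq : HasGradientAt q (-(2 / (r ^ 2 - r' ^ 2)) • (x - y)) x := by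
      rw [hasGradientAt_iff_hasFDerivAt]
      have h1 : HasFDerivAt (fun x => ‖x - y‖ ^ 2)
          (2 • (innerSL ℝ (x - y)).comp (ContinuousLinearMap.id ℝ _)) x :=
        ((hasFDerivAt_id x).sub_const y).norm_sq
      have h2 := (h1.const_sub (r ^ 2)).mul_const (r ^ 2 - r' ^ 2)⁻¹
      refine h2.congr_fderiv ?_
      ext z
      simp
      ring
    have hS : HasDerivAt Real.smoothTransition (deriv Real.smoothTransition (q x)) (q x) :=
      ((Real.smoothTransition.contDiff (n := 1)).differentiable one_ne_zero _).hasDerivAt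
    have hg : HasGradientAt (fun x => Real.smoothTransition (q x))
        (deriv Real.smoothTransition (q x) • (-(2 / (r ^ 2 - r' ^ 2)) • (x - y))) x := by
      rw [hasGradientAt_iff_hasFDerivAt]
      refine (hS.comp_hasFDerivAt x hdq.hasFDerivAt).congr_fderiv ?_
      ext z
      simp
    rw [hg.gradient, norm_smul, norm_smul, Real.norm_eq_abs, Real.norm_eq_abs, abs_neg,
      abs_of_pos (show 0 < 2 / (r ^ 2 - r' ^ 2) by positivity)]
    have h3 : 2 / (r ^ 2 - r' ^ 2) * ‖x - y‖ ≤ 2 / (r - r') := by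
      rw [div_mul_eq_mul_div, div_le_div_iff₀ hD hd]
      nlinarith [mul_pos hd hd, mul_nonneg hd.le (sub_nonneg.2 hx), mul_pos hd hr']
    calc _ ≤ C * (2 / (r - r')) := by
          gcongr
          exact hC _
      _ = _ := by ring

/-- A continuous weak subsolution of `div (A Du) ≥ f(u)` in an open set, with `f ≥ 0` and `A`
uniformly elliptic. -/
structure EllipticSubsolution (lam Lam : ℝ) (U : Set (EuclideanSpace ℝ (Fin n)))
    (A : EuclideanSpace ℝ (Fin n) → Matrix (Fin n) (Fin n) ℝ) (f : ℝ → ℝ)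
    (u : EuclideanSpace ℝ (Fin n) → ℝ)
    (Du : EuclideanSpace ℝ (Fin n) → EuclideanSpace ℝ (Fin n)) : Prop where
  isOpen : IsOpen U
  elliptic : IsUniformlyElliptic lam Lam U A
  nonneg : ∀ t, 0 ≤ f t
  continuousOn : ContinuousOn u U
  isW12 : IsW12 U u Du
  subsolution : IsSubsolutionGrad A f U u Du

/-- The Sobolev inequality is applied to `η (u - k)₊²`, and the part of its gradient containing `Du`
is controlled by the Caccioppoli inequality, whose `f` term is dropped by sign. -/
theorem exists_integral_truncation_le (hn : 1 ≤ n) {lam Lam : ℝ} (hlam : 0 < lam)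
    (hLam : lam ≤ Lam) :
    ∃ C : ℝ, 0 < C ∧ ∀ (U : Set (EuclideanSpace ℝ (Fin n)))
      (A : EuclideanSpace ℝ (Fin n) → Matrix (Fin n) (Fin n) ℝ) (f : ℝ → ℝ)
      (u : EuclideanSpace ℝ (Fin n) → ℝ)
      (Du : EuclideanSpace ℝ (Fin n) → EuclideanSpace ℝ (Fin n)),
      EllipticSubsolution lam Lam U A f u Du →
      ∀ (η : EuclideanSpace ℝ (Fin n) → ℝ) (k : ℝ) (S : Set (EuclideanSpace ℝ (Fin n))),
      IsTestFunction U η → MeasurableSet S → S ⊆ U → volume S ≠ ⊤ →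
      (∀ x ∈ U, x ∉ S → η x * max (u x - k) 0 ^ 2 = 0) →
      ∫ x in U, (η x * max (u x - k) 0 ^ 2) ^ 2 ≤ C * volume.real S ^ (2 / n : ℝ) *
        ∫ x in U, ‖max (u x - k) 0 ^ 2 • gradient η x‖ ^ 2 := by
  obtain ⟨C, hC0, hC⟩ := exists_integral_sq_le_of_isW12Zero hn
  have hLam0 : 0 < Lam := hlam.trans_le hLam
  refine ⟨C * (2 + 4 * (Lam / lam)), by positivity,
    fun U A f u Du ⟨hU, hA, hf, hu, hDu, hsub⟩ η k S hη hS hSU hSfin hSη => ?_⟩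
  obtain ⟨-, hcac⟩ := caccioppoli hlam hU hA hu hDu hsub hη k
  have hvc : ContinuousOn (fun x => max (u x - k) 0) U :=
    (hu.sub continuousOn_const).sup continuousOn_const
  have hφ := hDu.isW12Zero_mul_comp hU hu hη (g := fun s => (max (s - k) 0) ^ 2)
    (g' := fun s => 2 * max (s - k) 0) (hasDerivAt_max_sq k) (by fun_prop)
  have h1 := hC U S hU hS hSU hSfin _ _ hφ hSη
  have hi1 := (hη.memLp_mul_smul hU hvc hDu.memLp_grad).integrable_norm_pow (p := 2) (by norm_num)
  have hi2 := (hη.memLp_smul_gradient hU (q := fun x => max (u x - k) 0 ^ 2)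
    (hvc.pow 2)).integrable_norm_pow (p := 2) (by norm_num)
  have hf0 : 0 ≤ ∫ x in U, f (u x) * (η x ^ 2 * max (u x - k) 0 ^ 3) :=
    integral_nonneg fun x => mul_nonneg (hf _) (mul_nonneg (sq_nonneg _)
      (pow_nonneg (le_max_right _ _) _))
  set I := ∫ x in U, ‖(η x * max (u x - k) 0) • Du x‖ ^ 2 with hI
  set J := ∫ x in U, ‖max (u x - k) 0 ^ 2 • gradient η x‖ ^ 2 with hJ
  have h2 : ∫ x in U, ‖max (u x - k) 0 ^ 2 • gradient η x
      + (η x * (2 * max (u x - k) 0)) • Du x‖ ^ 2 ≤ 2 * J + 8 * I := by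
    rw [hI, hJ, ← integral_const_mul, ← integral_const_mul,
      ← integral_add (hi2.const_mul _) (hi1.const_mul _)]
    refine integral_mono (hφ.isW12.memLp_grad.integrable_norm_pow (by norm_num))
      ((hi2.const_mul _).add (hi1.const_mul _)) fun x => ?_
    have h3 : (η x * (2 * max (u x - k) 0)) • Du x
        = (2 : ℝ) • ((η x * max (u x - k) 0) • Du x) := by module
    beta_reduce
    rw [h3]
    have h4 := norm_add_le (max (u x - k) 0 ^ 2 • gradient η x)
      ((2 : ℝ) • ((η x * max (u x - k) 0) • Du x))
    rw [norm_smul (2 : ℝ), Real.norm_eq_abs, abs_of_pos (by norm_num : (0 : ℝ) < 2)] at h4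
    have h5 := pow_le_pow_left₀ (norm_nonneg _) h4 2
    nlinarith [sq_nonneg (‖max (u x - k) 0 ^ 2 • gradient η x‖
      - 2 * ‖(η x * max (u x - k) 0) • Du x‖)]
  have h6 : 8 * I ≤ 4 * (Lam / lam) * J := by
    have : 2 * lam * I ≤ Lam * J := by linarith
    calc 8 * I = 4 / lam * (2 * lam * I) := by field_simp; ring
      _ ≤ 4 / lam * (Lam * J) := by gcongr
      _ = _ := by field_simp
  have hr0 : 0 ≤ volume.real S ^ (2 / n : ℝ) := by positivity
  calc _ ≤ _ := h1
    _ ≤ C * volume.real S ^ (2 / n : ℝ) * ((2 + 4 * (Lam / lam)) * J) := by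
        gcongr
        linarith
    _ = _ := by ring

end DeGiorgi

/-! ### De Giorgi iteration and the growth estimate -/

section LevelSets

variable {n : ℕ}

theorem measurableSet_superlevel {U B : Set (EuclideanSpace ℝ (Fin n))} (hU : IsOpen U)
    {u : EuclideanSpace ℝ (Fin n) → ℝ} (hu : ContinuousOn u U) (hB : MeasurableSet B)
    (hBU : B ⊆ U) (k : ℝ) : MeasurableSet {x | x ∈ B ∧ k < u x} := by
  have h1 : {x | x ∈ B ∧ k < u x} = B ∩ (U ∩ u ⁻¹' Set.Ioi k) := by
    ext x
    constructor
    · rintro ⟨hx, hk⟩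
      exact ⟨hx, hBU hx, hk⟩
    · rintro ⟨hx, -, hk⟩
      exact ⟨hx, hk⟩
  rw [h1]
  exact hB.inter (hu.isOpen_inter_preimage hU isOpen_Ioi).measurableSet

theorem setIntegral_le_mul_measureReal {X : Type*} [MeasurableSpace X] {μ : Measure X}
    {U S : Set X} (hU : MeasurableSet U) (hS : MeasurableSet S) (hSU : S ⊆ U) (hSfin : μ S ≠ ⊤)
    {h : X → ℝ} (h0 : ∀ x, 0 ≤ h x) {c : ℝ} (hc : ∀ x ∈ S, h x ≤ c)
    (hz : ∀ x ∈ U, x ∉ S → h x = 0) : ∫ x in U, h x ∂μ ≤ c * μ.real S := by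
  have h1 : ∫ x in U, S.indicator (fun _ => c) x ∂μ = c * μ.real S := by
    rw [setIntegral_indicator hS, Set.inter_eq_self_of_subset_right hSU, setIntegral_const,
      smul_eq_mul, mul_comm]
  rw [← h1]
  refine integral_mono_of_nonneg (ae_of_all _ h0) ?_ ?_
  · rw [integrable_indicator_iff hS]
    refine integrableOn_const ?_ (by simp)
    rw [Measure.restrict_apply hS, Set.inter_eq_self_of_subset_left hSU]
    exact hSfin
  · filter_upwards [ae_restrict_mem hU] with x hx
    by_cases hxS : x ∈ S
    · simpa [hxS] using hc x hxS
    · simp [hxS, hz x hx hxS]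

theorem mul_measureReal_le_setIntegral {X : Type*} [MeasurableSpace X] {μ : Measure X}
    {U S : Set X} (hU : MeasurableSet U) (hS : MeasurableSet S) (hSU : S ⊆ U)
    {h : X → ℝ} (h0 : ∀ x ∈ U, 0 ≤ h x) (hi : IntegrableOn h U μ) {c : ℝ} (hc0 : 0 ≤ c)
    (hc : ∀ x ∈ S, c ≤ h x) : c * μ.real S ≤ ∫ x in U, h x ∂μ := by
  have h1 : ∫ x in U, S.indicator (fun _ => c) x ∂μ = c * μ.real S := by
    rw [setIntegral_indicator hS, Set.inter_eq_self_of_subset_right hSU, setIntegral_const,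
      smul_eq_mul, mul_comm]
  rw [← h1]
  refine integral_mono_of_nonneg (ae_of_all _ fun x => Set.indicator_nonneg (fun _ _ => hc0) x)
    hi ?_
  filter_upwards [ae_restrict_mem hU] with x hx
  by_cases hxS : x ∈ S
  · simpa [hxS] using hc x hxS
  · simpa [hxS] using h0 x hx

theorem IsTestFunction.of_tsupport_subset {U V : Set (EuclideanSpace ℝ (Fin n))}
    {η : EuclideanSpace ℝ (Fin n) → ℝ} (hη : IsTestFunction V η) (h : tsupport η ⊆ U) :
    IsTestFunction U η :=
  ⟨hη.smooth, hη.compact_support, h⟩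

/-- One step of De Giorgi's iteration. -/
theorem exists_superlevel_step (hn : 1 ≤ n) {lam Lam : ℝ} (hlam : 0 < lam) (hLam : lam ≤ Lam) :
    ∃ C : ℝ, 0 < C ∧ ∀ (U : Set (EuclideanSpace ℝ (Fin n)))
      (A : EuclideanSpace ℝ (Fin n) → Matrix (Fin n) (Fin n) ℝ) (f : ℝ → ℝ)
      (u : EuclideanSpace ℝ (Fin n) → ℝ)
      (Du : EuclideanSpace ℝ (Fin n) → EuclideanSpace ℝ (Fin n)),
      EllipticSubsolution lam Lam U A f u Du →
      ∀ (y : EuclideanSpace ℝ (Fin n)) (r' r k k' T : ℝ), 0 < r' → r' < r →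
      Metric.closedBall y r ⊆ U → (∀ x ∈ Metric.closedBall y r, u x ≤ T) → 0 ≤ T → 0 ≤ k →
      k < k' →
      (k' - k) ^ 4 * volume.real {x | x ∈ Metric.closedBall y r' ∧ k' < u x} ≤
        C * volume.real {x | x ∈ Metric.closedBall y r ∧ k < u x} ^ (1 + 2 / n : ℝ)
          * (T ^ 4 / (r - r') ^ 2) := by
  obtain ⟨C, hC0, hC⟩ := exists_integral_truncation_le hn hlam hLam
  obtain ⟨Cη, hCη0, hcut⟩ := exists_cutoff
  refine ⟨C * Cη ^ 2, by positivity,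
    fun U A f u Du hdata y r' r k k' T hr' hr hBU hT hT0 hk hkk' => ?_⟩
  obtain ⟨η, hη0, hηs, hη1, hηg⟩ := hcut n y r' r hr' hr
  have hη : IsTestFunction U η := hη0.of_tsupport_subset (hηs.trans hBU)
  have hU := hdata.isOpen
  have hu := hdata.continuousOn
  set S := {x | x ∈ Metric.closedBall y r ∧ k < u x} with hSdef
  set S' := {x | x ∈ Metric.closedBall y r' ∧ k' < u x} with hS'def
  have hB'B : Metric.closedBall y r' ⊆ Metric.closedBall y r :=
    Metric.closedBall_subset_closedBall hr.le
  have hSm : MeasurableSet S :=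
    measurableSet_superlevel hU hu Metric.isClosed_closedBall.measurableSet hBU k
  have hS'm : MeasurableSet S' :=
    measurableSet_superlevel hU hu Metric.isClosed_closedBall.measurableSet (hB'B.trans hBU) k'
  have hSU : S ⊆ U := fun x hx => hBU hx.1
  have hS'U : S' ⊆ U := fun x hx => hBU (hB'B hx.1)
  have hSfin : volume S ≠ ⊤ := ((measure_mono fun x hx => hx.1).trans_lt
    (measure_closedBall_lt_top (x := y) (r := r))).ne
  have hzero : ∀ x, x ∉ S → η x = 0 ∧ gradient η x = 0 ∨ max (u x - k) 0 = 0 := by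
    intro x hx
    by_cases hxB : x ∈ Metric.closedBall y r
    · right
      have : ¬ k < u x := fun h => hx ⟨hxB, h⟩
      exact max_eq_right (by linarith)
    · left
      exact ⟨image_eq_zero_of_notMem_tsupport fun h => hxB (hηs h),
        by_contra fun h0 => hxB (hηs (support_gradient_subset η h0))⟩
  have h1 := hC U A f u Du hdata η k S hη hSm hSU hSfin (fun x _ hx => by
    rcases hzero x hx with h | h
    · rw [h.1, zero_mul]
    · rw [h]; simp)
  have hmem := (hdata.isW12.isW12Zero_mul_comp hU hu hη (g := fun s => (max (s - k) 0) ^ 2)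
    (g' := fun s => 2 * max (s - k) 0) (hasDerivAt_max_sq k) (by fun_prop)).isW12.memLp
  -- Chebyshev's inequality: on `S'` the cutoff equals `1` and the truncation is at least `k' - k`.
  have h2 : (k' - k) ^ 4 * volume.real S' ≤ ∫ x in U, (η x * max (u x - k) 0 ^ 2) ^ 2 := by
    refine mul_measureReal_le_setIntegral hU.measurableSet hS'm hS'U (fun x _ => sq_nonneg _)
      hmem.integrable_sq (by positivity) fun x hx => ?_
    rw [hη1 x hx.1, one_mul, ← pow_mul]
    have h3 : k' - k ≤ max (u x - k) 0 := le_max_of_le_left (by linarith [hx.2])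
    have h4 : 0 ≤ k' - k := by linarith
    gcongr
  have h3 : ∫ x in U, ‖max (u x - k) 0 ^ 2 • gradient η x‖ ^ 2
      ≤ (T ^ 2 * (Cη / (r - r'))) ^ 2 * volume.real S := by
    refine setIntegral_le_mul_measureReal hU.measurableSet hSm hSU hSfin (fun x => sq_nonneg _)
      (fun x hx => ?_) (fun x _ hx => ?_)
    · rw [norm_smul, norm_pow, Real.norm_eq_abs, abs_of_nonneg (le_max_right _ _)]
      have h5 : max (u x - k) 0 ≤ T := max_le (by linarith [hT x hx.1]) hT0
      have h6 := hηg x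
      gcongr
    · rcases hzero x hx with h | h
      · rw [h.2]; simp
      · rw [h]; simp
  have hS0 : 0 ≤ volume.real S := measureReal_nonneg
  have hpow : volume.real S ^ (2 / n : ℝ) * volume.real S = volume.real S ^ (1 + 2 / n : ℝ) := by
    rw [add_comm, Real.rpow_add_one' hS0 (by positivity)]
  have hr0 : 0 < r - r' := by linarith
  calc _ ≤ _ := h2
    _ ≤ _ := h1
    _ ≤ C * volume.real S ^ (2 / n : ℝ) * ((T ^ 2 * (Cη / (r - r'))) ^ 2 * volume.real S) := by
        gcongr
    _ = C * (volume.real S ^ (2 / n : ℝ) * volume.real S) * (T ^ 2 * (Cη / (r - r'))) ^ 2 := by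
        ring
    _ = _ := by
        rw [hpow]
        field_simp

/-- The bound `b j ≤ δ q ^ j` reproduces itself: `q` is chosen so that `B q ^ α = 1`, which cancels
the growing factor, and `δ` so that `K δ ^ α = q`. -/
theorem exists_iteration_threshold {K B α : ℝ} (hK : 0 < K) (hB : 1 < B) (hα : 0 < α) :
    ∃ δ : ℝ, 0 < δ ∧ ∀ b : ℕ → ℝ, (∀ j, 0 ≤ b j) →
      (∀ j, b (j + 1) ≤ K * B ^ j * b j ^ (1 + α)) → b 0 ≤ δ → Tendsto b atTop (𝓝 0) := by
  have hB0 : 0 < B := by linarith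
  set q : ℝ := B ^ (-(1 / α)) with hq
  have hq0 : 0 < q := Real.rpow_pos_of_pos hB0 _
  have hq1 : q < 1 := Real.rpow_lt_one_of_one_lt_of_neg hB (by simpa using hα)
  have hqα : B * q ^ α = 1 := by
    rw [hq, ← Real.rpow_mul hB0.le, show -(1 / α) * α = -1 by field_simp, Real.rpow_neg_one]
    field_simp
  set δ : ℝ := (q / K) ^ (1 / α) with hδ
  have hδ0 : 0 < δ := by positivity
  have hδα : K * δ ^ α = q := by
    rw [hδ, ← Real.rpow_mul (by positivity), one_div_mul_cancel hα.ne', Real.rpow_one]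
    field_simp
  refine ⟨δ, hδ0, fun b hb hstep h0 => ?_⟩
  have hbound : ∀ j, b j ≤ δ * q ^ j := by
    intro j
    induction j with
    | zero => simpa using h0
    | succ j ih =>
      have hpos : 0 < δ * q ^ j := by positivity
      calc b (j + 1) ≤ K * B ^ j * b j ^ (1 + α) := hstep j
        _ ≤ K * B ^ j * (δ * q ^ j) ^ (1 + α) := by
            gcongr
            exact hb j
        _ = δ * q ^ j * (K * δ ^ α) * (B * q ^ α) ^ j := by
            rw [Real.rpow_add hpos, Real.rpow_one, Real.mul_rpow hδ0.le (by positivity), mul_pow,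
              ← Real.rpow_natCast q j, ← Real.rpow_mul hq0.le, mul_comm (j : ℝ) α,
              Real.rpow_mul hq0.le, Real.rpow_natCast (q ^ α) j, Real.rpow_natCast q j]
            ring
        _ = δ * q ^ (j + 1) := by
            rw [hδα, hqα, one_pow]
            ring
  have hlim : Tendsto (fun j : ℕ => δ * q ^ j) atTop (𝓝 0) := by
    simpa using (tendsto_pow_atTop_nhds_zero_of_lt_one hq0.le hq1).const_mul δ
  exact tendsto_of_tendsto_of_tendsto_of_le_of_le tendsto_const_nhds hlim hb hbound

/-- De Giorgi's lemma: a bounded subsolution which is small except on a set of small measure is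
small at the center. -/
theorem exists_deGiorgi_threshold (hn : 1 ≤ n) {lam Lam : ℝ} (hlam : 0 < lam)
    (hLam : lam ≤ Lam) :
    ∃ δ : ℝ, 0 < δ ∧ ∀ (U : Set (EuclideanSpace ℝ (Fin n)))
      (A : EuclideanSpace ℝ (Fin n) → Matrix (Fin n) (Fin n) ℝ) (f : ℝ → ℝ)
      (u : EuclideanSpace ℝ (Fin n) → ℝ)
      (Du : EuclideanSpace ℝ (Fin n) → EuclideanSpace ℝ (Fin n)),
      EllipticSubsolution lam Lam U A f u Du →
      ∀ (y : EuclideanSpace ℝ (Fin n)) (ρ t : ℝ), 0 < ρ → 0 < t →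
      Metric.closedBall y ρ ⊆ U → (∀ x ∈ Metric.closedBall y ρ, u x ≤ 2 * t) →
      volume.real {x | x ∈ Metric.closedBall y ρ ∧ t / 2 < u x} ≤ δ * ρ ^ n →
      u y ≤ 3 / 4 * t := by
  obtain ⟨C, hC0, hC⟩ := exists_superlevel_step hn hlam hLam
  have hn0 : (0 : ℝ) < n := by exact_mod_cast hn
  -- Level gaps `(t/8) 2⁻ʲ` enter to the fourth power and radius gaps `(ρ/4) 2⁻ʲ` to the second,
  -- which gives `2 ^ (6 j) = 64 ^ j`. The bound `2 t` contributes `2 ^ 4`, so the prefactor is `2 ^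
  -- 4 * 2 ^ 4 * 8 ^ 4 = 2 ^ 20`.
  obtain ⟨δ, hδ0, hδ⟩ := exists_iteration_threshold (K := C * 2 ^ 20) (B := 64) (α := 2 / n)
    (by positivity) (by norm_num) (by positivity)
  refine ⟨δ, hδ0, fun U A f u Du hdata y ρ t hρ ht hBU hT hsmall => ?_⟩
  -- Radii decrease from `ρ` to `ρ / 2`, while levels rise from `t / 2` to `3 t / 4`.
  let r : ℕ → ℝ := fun j => ρ / 2 * (1 + (1 / 2) ^ j)
  let k : ℕ → ℝ := fun j => 3 / 4 * t - t / 4 * (1 / 2) ^ j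
  let a : ℕ → ℝ := fun j => volume.real {x | x ∈ Metric.closedBall y (r j) ∧ k j < u x}
  have hpow0 : ∀ j : ℕ, (0 : ℝ) < (1 / 2) ^ j := fun j => by positivity
  have hpow1 : ∀ j : ℕ, ((1 : ℝ) / 2) ^ j ≤ 1 := fun j => pow_le_one₀ (by norm_num) (by norm_num)
  have hrρ : ∀ j, r j ≤ ρ := fun j => by
    have := hpow1 j
    simp only [r]; nlinarith
  have hρn : 0 < ρ ^ n := by positivity
  have hstep : ∀ j, a (j + 1) / ρ ^ n
      ≤ C * 2 ^ 20 * 64 ^ j * (a j / ρ ^ n) ^ (1 + 2 / n : ℝ) := by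
    intro j
    have hx := hpow0 j
    have hr1 : 0 < r (j + 1) := by simp only [r]; positivity
    have hr2 : r j - r (j + 1) = ρ / 4 * (1 / 2) ^ j := by simp only [r, pow_succ]; ring
    have hk2 : k (j + 1) - k j = t / 8 * (1 / 2) ^ j := by simp only [k, pow_succ]; ring
    have hk0 : 0 ≤ k j := by
      have := hpow1 j
      simp only [k]; nlinarith
    have h1 := hC U A f u Du hdata y (r (j + 1)) (r j) (k j) (k (j + 1)) (2 * t) hr1
      (by have : 0 < ρ / 4 * (1 / 2) ^ j := by positivity
          linarith)
      ((Metric.closedBall_subset_closedBall (hrρ j)).trans hBU)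
      (fun x hx => hT x (Metric.closedBall_subset_closedBall (hrρ j) hx)) (by positivity) hk0
      (by have : 0 < t / 8 * (1 / 2) ^ j := by positivity
          linarith)
    rw [hr2, hk2] at h1
    change (t / 8 * (1 / 2) ^ j) ^ 4 * a (j + 1) ≤ C * a j ^ (1 + 2 / n : ℝ) * _ at h1
    have ha0 : 0 ≤ a j := measureReal_nonneg
    -- Scale invariance: `n (1 + 2 / n) = n + 2`, and the extra `ρ ^ 2` cancels the squared radius
    -- gap.
    have hscale : (a j / ρ ^ n) ^ (1 + 2 / n : ℝ) * (ρ ^ n * ρ ^ 2) = a j ^ (1 + 2 / n : ℝ) := by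
      rw [Real.div_rpow ha0 hρn.le]
      have : (ρ ^ n) ^ (1 + 2 / n : ℝ) = ρ ^ n * ρ ^ 2 := by
        rw [← Real.rpow_natCast ρ n, ← Real.rpow_mul hρ.le, ← Real.rpow_natCast ρ 2,
          ← Real.rpow_add hρ]
        congr 1
        push_cast
        field_simp
      rw [this]
      field_simp
    rw [← hscale] at h1
    set b := (a j / ρ ^ n) ^ (1 + 2 / n : ℝ) with hb
    have h64 : (64 : ℝ) ^ j * ((1 / 2) ^ j) ^ 6 = 1 := by
      rw [← pow_mul, mul_comm j 6, pow_mul, ← mul_pow]; norm_num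
    set z : ℝ := (1 / 2) ^ j with hz
    have hz64 : (64 : ℝ) ^ j = 1 / z ^ 6 := by
      rw [eq_div_iff (by positivity)]; exact h64
    rw [div_le_iff₀ hρn, hz64]
    have h2 : a (j + 1) ≤ C * (b * (ρ ^ n * ρ ^ 2)) * ((2 * t) ^ 4 / (ρ / 4 * z) ^ 2)
        / (t / 8 * z) ^ 4 := by
      rw [le_div_iff₀ (by positivity), mul_comm]
      exact h1
    refine h2.trans (le_of_eq ?_)
    field_simp
    ring
  have h0 : a 0 / ρ ^ n ≤ δ := by
    rw [div_le_iff₀ hρn]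
    refine le_trans (le_of_eq ?_) hsmall
    simp only [a, r, k]
    rw [show ρ / 2 * (1 + (1 / 2) ^ 0) = ρ by ring,
      show 3 / 4 * t - t / 4 * (1 / 2) ^ 0 = t / 2 by ring]
  have hlim := hδ (fun j => a j / ρ ^ n) (fun j => by positivity) hstep h0
  by_contra hcon
  rw [not_le] at hcon
  have hyU : y ∈ U := hBU (Metric.mem_closedBall_self hρ.le)
  -- By continuity a whole ball about `y` would lie in every superlevel set of the iteration, so
  -- their measures could not tend to zero.
  have hnhds : ∀ᶠ x in 𝓝 y, 3 / 4 * t < u x :=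
    (hdata.continuousOn.continuousAt (hdata.isOpen.mem_nhds hyU)).eventually
      (lt_mem_nhds hcon)
  obtain ⟨s, hs, hsu⟩ := Metric.eventually_nhds_iff_ball.1 hnhds
  set s' := min s (ρ / 2) with hs'
  have hs'0 : 0 < s' := by positivity
  have hvol : 0 < volume.real (Metric.ball y s') := by
    rw [measureReal_def]
    exact ENNReal.toReal_pos (Metric.measure_ball_pos volume y hs'0).ne' measure_ball_lt_top.ne
  have hge : ∀ j, volume.real (Metric.ball y s') / ρ ^ n ≤ a j / ρ ^ n := by
    intro j
    gcongr
    refine measureReal_mono (fun x hx => ⟨?_, ?_⟩) ?_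
    · rw [Metric.mem_ball] at hx
      rw [Metric.mem_closedBall]
      have := hpow0 j
      have h1 : s' ≤ ρ / 2 := min_le_right _ _
      simp only [r]; nlinarith
    · have := hsu x (Metric.ball_subset_ball (min_le_left _ _) hx)
      have := hpow0 j
      simp only [k]; nlinarith
    · exact ((measure_mono fun x hx => hx.1).trans_lt
        (measure_closedBall_lt_top (x := y) (r := r j))).ne
  have := ge_of_tendsto' hlim hge
  have : 0 < volume.real (Metric.ball y s') / ρ ^ n := by positivity
  linarith

/-- A subsolution at least `t` at the center of a ball and at most `2 t` in the ball: the radius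
of the ball is controlled. -/
theorem exists_sq_mul_le_of_le_two_mul (hn : 1 ≤ n) {lam Lam : ℝ} (hlam : 0 < lam)
    (hLam : lam ≤ Lam) :
    ∃ C : ℝ, 0 < C ∧ ∀ (U : Set (EuclideanSpace ℝ (Fin n)))
      (A : EuclideanSpace ℝ (Fin n) → Matrix (Fin n) (Fin n) ℝ) (f : ℝ → ℝ)
      (u : EuclideanSpace ℝ (Fin n) → ℝ)
      (Du : EuclideanSpace ℝ (Fin n) → EuclideanSpace ℝ (Fin n)),
      EllipticSubsolution lam Lam U A f u Du → Monotone f →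
      ∀ (y : EuclideanSpace ℝ (Fin n)) (ρ t : ℝ), 0 < ρ → 0 < t →
      Metric.closedBall y ρ ⊆ U → (∀ x ∈ Metric.closedBall y ρ, u x ≤ 2 * t) → t ≤ u y →
      ρ ^ 2 * f (t / 2) ≤ C * t := by
  obtain ⟨δ, hδ0, hδ⟩ := exists_deGiorgi_threshold hn hlam hLam
  obtain ⟨Cη, hCη0, hcut⟩ := exists_cutoff
  have hLam0 : 0 < Lam := hlam.trans_le hLam
  set ω : ℝ := volume.real (Metric.ball (0 : EuclideanSpace ℝ (Fin n)) 1) with hω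
  have hω0 : 0 ≤ ω := measureReal_nonneg
  -- Here `512 = 8 * 64`: the `8` and `2 ^ n` come from `(t / 2) ^ 3` and `(ρ / 2) ^ n`, the `64`
  -- from the square of `(2 t) ^ 2 * (Cη / (ρ / 2))`.
  refine ⟨512 * 2 ^ n * Lam * Cη ^ 2 * ω / δ + 1, by positivity,
    fun U A f u Du hdata hmono y ρ t hρ ht hBU hT hy => ?_⟩
  have hU := hdata.isOpen
  have hu := hdata.continuousOn
  have hB' : Metric.closedBall y (ρ / 2) ⊆ Metric.closedBall y ρ :=
    Metric.closedBall_subset_closedBall (by linarith)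
  set S := {x | x ∈ Metric.closedBall y (ρ / 2) ∧ t / 2 < u x} with hSdef
  -- Otherwise De Giorgi's lemma on the half ball would give `u y ≤ 3 t / 4 < t`.
  have hlarge : δ * (ρ / 2) ^ n < volume.real S := by
    by_contra h
    have := hδ U A f u Du hdata y (ρ / 2) t (by positivity) ht (hB'.trans hBU)
      (fun x hx => hT x (hB' hx)) (not_lt.1 h)
    linarith
  obtain ⟨η, hη0, hηs, hη1, hηg⟩ := hcut n y (ρ / 2) ρ (by positivity) (by linarith)
  have hη : IsTestFunction U η := hη0.of_tsupport_subset (hηs.trans hBU)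
  -- At level `0` the `f` term is now the one kept, and the gradient term is discarded.
  obtain ⟨hint, hcac⟩ := caccioppoli hlam hU hdata.elliptic hu hdata.isW12 hdata.subsolution hη 0
  have hSm : MeasurableSet S := measurableSet_superlevel hU hu
    Metric.isClosed_closedBall.measurableSet (hB'.trans hBU) _
  have h1 : f (t / 2) * (t / 2) ^ 3 * volume.real S
      ≤ ∫ x in U, f (u x) * (η x ^ 2 * max (u x - 0) 0 ^ 3) := by
    refine mul_measureReal_le_setIntegral hU.measurableSet hSm (fun x hx => hBU (hB' hx.1))
      (fun x _ => ?_) hint ?_ (fun x hx => ?_)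
    · exact mul_nonneg (hdata.nonneg _) (mul_nonneg (sq_nonneg _)
        (pow_nonneg (le_max_right _ _) _))
    · exact mul_nonneg (hdata.nonneg _) (by positivity)
    · rw [hη1 x hx.1, one_pow, one_mul]
      have h2 : t / 2 ≤ max (u x - 0) 0 := le_max_of_le_left (by linarith [hx.2])
      have h3 := hmono hx.2.le
      have h4 := hdata.nonneg (t / 2)
      have h5 := hdata.nonneg (u x)
      gcongr
  have h2 : ∫ x in U, ‖max (u x - 0) 0 ^ 2 • gradient η x‖ ^ 2
      ≤ ((2 * t) ^ 2 * (Cη / (ρ - ρ / 2))) ^ 2 * volume.real (Metric.closedBall y ρ) := by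
    refine setIntegral_le_mul_measureReal hU.measurableSet
      Metric.isClosed_closedBall.measurableSet hBU measure_closedBall_lt_top.ne
      (fun x => sq_nonneg _) (fun x hx => ?_) (fun x _ hx => ?_)
    · rw [norm_smul, norm_pow, Real.norm_eq_abs, abs_of_nonneg (le_max_right _ _)]
      have h5 : max (u x - 0) 0 ≤ 2 * t := max_le (by linarith [hT x hx]) (by positivity)
      have h6 := hηg x
      gcongr
    · have : gradient η x = 0 := by_contra fun h0 => hx (hηs (support_gradient_subset η h0))
      rw [this]; simp
  have hvol : volume.real (Metric.closedBall y ρ) = ρ ^ n * ω := by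
    rw [Measure.addHaar_real_closedBall _ _ hρ.le]
    simp [hω]
  rw [hvol] at h2
  have hI0 : 0 ≤ ∫ x in U, ‖(η x * max (u x - 0) 0) • Du x‖ ^ 2 :=
    integral_nonneg fun x => sq_nonneg _
  have h3 : f (t / 2) * (t / 2) ^ 3 * (δ * (ρ / 2) ^ n)
      ≤ Lam * (((2 * t) ^ 2 * (Cη / (ρ - ρ / 2))) ^ 2 * (ρ ^ n * ω)) := by
    have hf0 : 0 ≤ f (t / 2) * (t / 2) ^ 3 := mul_nonneg (hdata.nonneg _) (by positivity)
    calc _ ≤ f (t / 2) * (t / 2) ^ 3 * volume.real S := by gcongr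
      _ ≤ _ := h1
      _ ≤ Lam * ∫ x in U, ‖max (u x - 0) 0 ^ 2 • gradient η x‖ ^ 2 := by
          have : 0 ≤ 2 * lam * ∫ x in U, ‖(η x * max (u x - 0) 0) • Du x‖ ^ 2 := by positivity
          linarith
      _ ≤ _ := by gcongr
  have h4 : ρ ^ 2 * f (t / 2) ≤ 512 * 2 ^ n * Lam * Cη ^ 2 * ω / δ * t := by
    have hc : 0 < t ^ 3 * δ * ρ ^ n / (8 * 2 ^ n * ρ ^ 2) := by positivity
    refine le_of_mul_le_mul_right ?_ hc
    calc ρ ^ 2 * f (t / 2) * (t ^ 3 * δ * ρ ^ n / (8 * 2 ^ n * ρ ^ 2))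
        = f (t / 2) * (t / 2) ^ 3 * (δ * (ρ / 2) ^ n) := by
          rw [div_pow ρ]; field_simp; ring
      _ ≤ _ := h3
      _ = _ := by
          rw [show ρ - ρ / 2 = ρ / 2 by ring]; field_simp; ring
  linarith

end LevelSets

/-! ### From the growth estimate to the Keller–Osserman integral -/

section KellerIntegral

variable {n : ℕ}

theorem primitive_le_mul {f : ℝ → ℝ} (hf : Monotone f) {s : ℝ} (hs : 0 ≤ s) :
    primitive f s ≤ s * f s := by
  have h1 : ∫ x in (0 : ℝ)..s, f x ≤ ∫ _x in (0 : ℝ)..s, f s :=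
    intervalIntegral.integral_mono_on hs hf.intervalIntegrable (by simp) fun x hx => hf hx.2
  simpa [primitive] using h1

/-- On the window `F(s) ≤ s f(s) ≤ t f(t/2) = G`, so the integral is at least `(t/4) / √G`, while
the hypothesis says `d √G ≤ t √D`. If `G = 0`, the integral is infinite. -/
theorem ofReal_le_kellerIntegral {f : ℝ → ℝ} (hf0 : ∀ t, 0 ≤ f t) (hf : Monotone f) {t d D : ℝ}
    (ht : 0 < t) (hD : 0 < D) (h : d ^ 2 * f (t / 2) ≤ D * t) :
    ENNReal.ofReal (1 / (4 * √D) * d) ≤ kellerIntegral f (t / 4) (t / 2) := by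
  set G : ℝ := t * f (t / 2) with hG
  have hG0 : 0 ≤ G := mul_nonneg ht.le (hf0 _)
  have hlow : (ENNReal.ofReal √G)⁻¹ * ENNReal.ofReal (t / 4) ≤ kellerIntegral f (t / 4) (t / 2) := by
    calc (ENNReal.ofReal √G)⁻¹ * ENNReal.ofReal (t / 4)
        = ∫⁻ _s in Set.Ioc (t / 4) (t / 2), (ENNReal.ofReal √G)⁻¹ := by
          rw [setLIntegral_const, Real.volume_Ioc, show t / 2 - t / 4 = t / 4 by ring]
      _ ≤ _ := by
          refine setLIntegral_mono' measurableSet_Ioc fun s hs => ?_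
          have hs0 : 0 ≤ s := by linarith [hs.1]
          have h1 := primitive_le_mul hf hs0
          have h2 : s * f s ≤ G := by
            have := hf hs.2
            have := hf0 s
            have := hs.2
            rw [hG]
            gcongr
            linarith
          gcongr
          exact h1.trans h2
  refine le_trans ?_ hlow
  rcases hG0.eq_or_lt with h0 | h0
  · rw [← h0, Real.sqrt_zero, ENNReal.ofReal_zero, ENNReal.inv_zero, ENNReal.top_mul]
    · exact le_top
    · simpa using ht
  · have hsG : 0 < √G := Real.sqrt_pos.2 h0
    have hsD : 0 < √D := Real.sqrt_pos.2 hD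
    rw [← ENNReal.ofReal_inv_of_pos hsG, ← ENNReal.ofReal_mul (by positivity)]
    apply ENNReal.ofReal_le_ofReal
    have h1 : d * √G ≤ t * √D := by
      refine le_of_sq_le_sq ?_ (by positivity)
      rw [mul_pow, mul_pow, Real.sq_sqrt hG0, Real.sq_sqrt hD.le]
      calc d ^ 2 * G = t * (d ^ 2 * f (t / 2)) := by rw [hG]; ring
        _ ≤ t * (D * t) := by gcongr
        _ = _ := by ring
    rw [inv_mul_eq_div, one_div_mul_eq_div, div_le_div_iff₀ (by positivity) hsG]
    linarith

theorem kellerIntegral_mono {f : ℝ → ℝ} {a a' b b' : ℝ} (ha : a' ≤ a) (hb : b ≤ b') :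
    kellerIntegral f a b ≤ kellerIntegral f a' b' :=
  lintegral_mono_set (Set.Ioc_subset_Ioc ha hb)

theorem kellerIntegral_add {f : ℝ → ℝ} {a b c : ℝ} (hab : a ≤ b) (hbc : b ≤ c) :
    kellerIntegral f a b + kellerIntegral f b c = kellerIntegral f a c := by
  rw [kellerIntegral, kellerIntegral, ← lintegral_union measurableSet_Ioc
    (Set.Ioc_disjoint_Ioc_of_le le_rfl), Set.Ioc_union_Ioc_eq_Ioc hab hbc, kellerIntegral]

/-- Induction on `N`, a bound for the number of doublings still possible below `M`. Each step pays
for the distance to a point of doubled height with the window `(t/4, t/2]`; the remaining distance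
is paid for from `t/2` to `M`. For `N = 0` the assumptions are contradictory. -/
theorem exists_ofReal_le_kellerIntegral (hn : 1 ≤ n) {lam Lam : ℝ} (hlam : 0 < lam)
    (hLam : lam ≤ Lam) :
    ∃ c : ℝ, 0 < c ∧ ∀ (U : Set (EuclideanSpace ℝ (Fin n)))
      (A : EuclideanSpace ℝ (Fin n) → Matrix (Fin n) (Fin n) ℝ) (f : ℝ → ℝ)
      (u : EuclideanSpace ℝ (Fin n) → ℝ)
      (Du : EuclideanSpace ℝ (Fin n) → EuclideanSpace ℝ (Fin n)),
      EllipticSubsolution lam Lam U A f u Du → Monotone f →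
      ∀ (x₀ : EuclideanSpace ℝ (Fin n)) (R M : ℝ), Metric.ball x₀ R ⊆ U →
      (∀ x ∈ Metric.ball x₀ R, u x ≤ M) →
      ∀ (N : ℕ) (t : ℝ), 0 < t → M < 2 ^ N * t → ∀ y ∈ Metric.ball x₀ R, t ≤ u y →
      ENNReal.ofReal (c * (R - dist y x₀)) ≤ kellerIntegral f (t / 4) M := by
  obtain ⟨C, hC0, hC⟩ := exists_sq_mul_le_of_le_two_mul hn hlam hLam
  refine ⟨1 / (4 * √(2 * C)), by positivity, fun U A f u Du hdata hf x₀ R M hBU hM N => ?_⟩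
  set c : ℝ := 1 / (4 * √(2 * C)) with hc
  have hc0 : 0 < c := by positivity
  induction N with
  | zero =>
    intro t ht hMt y hy hty
    have := hM y hy
    simp only [pow_zero, one_mul] at hMt
    linarith
  | succ N ih =>
    intro t ht hMt y hy hty
    have hyM := hM y hy
    have hd : 0 < R - dist y x₀ := by
      rw [Metric.mem_ball] at hy; linarith
    have hf0 := hdata.nonneg (t / 2)
    -- The chain ends here: one window already pays for the whole distance to the boundary. This
    -- case includes `f (t / 2) = 0`.
    by_cases hcase : (R - dist y x₀) ^ 2 * f (t / 2) ≤ 2 * C * t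
    · exact (ofReal_le_kellerIntegral hdata.nonneg hf ht (by positivity) hcase).trans
        (kellerIntegral_mono le_rfl (by linarith))
    rw [not_le] at hcase
    have hfpos : 0 < f (t / 2) := by
      refine hf0.lt_of_ne fun h0 => ?_
      rw [← h0, mul_zero] at hcase
      have : 0 < 2 * C * t := by positivity
      linarith
    -- With this radius `ρ² f(t/2) = 2 C t`, twice what the growth estimate allows, so `u ≤ 2 t`
    -- must fail somewhere in the ball.
    set ρ : ℝ := √(2 * C * t / f (t / 2)) with hρ
    have hρ0 : 0 < ρ := Real.sqrt_pos.2 (by positivity)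
    have hρ2 : ρ ^ 2 * f (t / 2) = 2 * C * t := by
      rw [hρ, Real.sq_sqrt (by positivity)]
      field_simp
    have hρd : ρ < R - dist y x₀ := by
      refine lt_of_pow_lt_pow_left₀ 2 hd.le ?_
      refine lt_of_mul_lt_mul_right ?_ hf0
      rw [hρ2]
      exact hcase
    have hsub : Metric.closedBall y ρ ⊆ Metric.ball x₀ R :=
      Metric.closedBall_subset_ball' (by linarith)
    obtain ⟨y', hy', hty'⟩ : ∃ y' ∈ Metric.closedBall y ρ, 2 * t < u y' := by
      by_contra! hcon
      have := hC U A f u Du hdata hf y ρ t hρ0 ht (hsub.trans hBU) hcon hty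
      rw [hρ2] at this
      have : 0 < C * t := by positivity
      linarith
    have hrest := ih (2 * t) (by positivity) (by rw [pow_succ] at hMt; linarith) y' (hsub hy')
      hty'.le
    rw [show 2 * t / 4 = t / 2 by ring] at hrest
    have hfirst := ofReal_le_kellerIntegral hdata.nonneg hf ht
      (show 0 < 2 * C by positivity) hρ2.le
    rw [← kellerIntegral_add (show t / 4 ≤ t / 2 by linarith) (show t / 2 ≤ M by linarith)]
    refine le_trans ?_ (add_le_add hfirst hrest)
    have hd' : 0 ≤ R - dist y' x₀ := by
      have := Metric.mem_ball.1 (hsub hy'); linarith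
    rw [← ENNReal.ofReal_add (by positivity) (by positivity)]
    apply ENNReal.ofReal_le_ofReal
    rw [← hc, ← mul_add]
    refine mul_le_mul_of_nonneg_left ?_ hc0.le
    have h1 := dist_triangle y' y x₀
    have h2 := Metric.mem_closedBall.1 hy'
    linarith

end KellerIntegral

end

/-! ### The main theorem -/

theorem theorem1p2 (n : ℕ) (hn : 1 ≤ n) (lam Lam : ℝ) (hlam : 0 < lam) (hLam : lam ≤ Lam) :
    ∃ c : ℝ, 0 < c ∧
      ∀ (A : EuclideanSpace ℝ (Fin n) → Matrix (Fin n) (Fin n) ℝ) (f : ℝ → ℝ)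
        (x₀ : EuclideanSpace ℝ (Fin n)) (R : ℝ) (u : EuclideanSpace ℝ (Fin n) → ℝ),
        0 < R →
        IsUniformlyElliptic lam Lam (Metric.ball x₀ (2 * R)) A →
        (∀ t, 0 ≤ f t) → Monotone f →
        ContinuousOn u (Metric.ball x₀ (2 * R)) →
        (∀ x ∈ Metric.ball x₀ (2 * R), 0 ≤ u x) →
        IsSubsolution A f (Metric.ball x₀ (2 * R)) u →
        0 < u x₀ →
        ENNReal.ofReal (c * R) ≤
          kellerIntegral f (sInf (u '' Metric.ball x₀ R) / 4) (sSup (u '' Metric.ball x₀ R)) := by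
  obtain ⟨c, hc0, hc⟩ := exists_ofReal_le_kellerIntegral hn hlam hLam
  refine ⟨c, hc0, fun A f x₀ R u hR hA hf0 hf hu hu0 ⟨Du, hDu, hsub⟩ hux => ?_⟩
  have hdata : EllipticSubsolution lam Lam (Metric.ball x₀ (2 * R)) A f u Du :=
    ⟨Metric.isOpen_ball, hA, hf0, hu, hDu, hsub⟩
  have hB : Metric.ball x₀ R ⊆ Metric.ball x₀ (2 * R) := Metric.ball_subset_ball (by linarith)
  have hx₀ : x₀ ∈ Metric.ball x₀ R := Metric.mem_ball_self hR
  -- The closed ball of radius `R` is compact in the domain, so `sSup` is the true supremum and not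
  -- the default value of an unbounded set.
  have hbdd : BddAbove (u '' Metric.ball x₀ R) :=
    ((isCompact_closedBall x₀ R).bddAbove_image
      (hu.mono (Metric.closedBall_subset_ball (by linarith)))).mono
      (Set.image_mono Metric.ball_subset_closedBall)
  have hbdd' : BddBelow (u '' Metric.ball x₀ R) :=
    ⟨0, by rintro _ ⟨x, hx, rfl⟩; exact hu0 x (hB hx)⟩
  set M := sSup (u '' Metric.ball x₀ R)
  have hM : ∀ x ∈ Metric.ball x₀ R, u x ≤ M := fun x hx => le_csSup hbdd ⟨x, hx, rfl⟩
  -- Positivity of `u x₀` makes finitely many doublings suffice to pass `M`.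
  obtain ⟨N, hN⟩ := pow_unbounded_of_one_lt (M / u x₀) (by norm_num : (1 : ℝ) < 2)
  have h := hc _ A f u Du hdata hf x₀ R M hB hM N (u x₀) hux ((div_lt_iff₀ hux).1 hN) x₀ hx₀ le_rfl
  rw [dist_self, sub_zero] at h
  refine h.trans (kellerIntegral_mono ?_ le_rfl)
  have : sInf (u '' Metric.ball x₀ R) ≤ u x₀ := csInf_le hbdd' ⟨x₀, hx₀, rfl⟩
  linarith
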